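/- Let $(M^5,g)$ be a smooth Riemannian 5-manifold with an almost contact metric structure $(\xi,\eta,\varphi)$, i.e. a smooth vector field $\xi$ of length one, its dual 1-form $\eta=g(\xi,\cdot)$ and a smooth endomorphism $\varphi$ of the tangent bundle with $\varphi(\xi)=0$, $\varphi^2=-\mathrm{Id}+\eta\otimes\xi$ and $g(\varphi X,\varphi Y)=g(X,Y)-\eta(X)\eta(Y)$. Let $\Phi(X,Y)=g(X,\varphi Y)$ be its fundamental form, and let $$N(X,Y,Z)=g\big(X,[\varphi,\varphi](Y,Z)\big)+\eta(X)\,d\eta(Y,Z),\qquad [\varphi,\varphi](X,Y)=[\varphi X,\varphi Y]+\varphi^2[X,Y]-\varphi[\varphi X,Y]-\varphi[X,\varphi Y]$$ be its Nijenhuis tensor, where $d\eta(X,Y)=X(\eta(Y))-Y(\eta(X))-\eta([X,Y])$. An adapted frame is a local smooth orthonormal frame $(e_1,\dots,e_5)$ with $\Phi=e_1\wedge e_2+e_3\wedge e_4$ and $\eta=e_5$ (vectors and covectors being identified by $g$); it is taken as positively oriented. Let $\Lambda^2$ be the space of 2-forms on the model space $\mathbb R^5$ (with the standard $\Phi=e_1\wedge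 e_2+e_3\wedge e_4$, $\eta=e_5$ and Hodge operator $\ast$), identified with $\mathfrak{so}(5)$ with inner product $\langle x,y\rangle=-\tfrac12\mathrm{tr}(x\circ y)$, and put $$\Lambda^2_1=\mathbb R\,\Phi,\quad \Lambda^2_2=\{\beta\mid\Phi\wedge\beta=0,\ \ast\beta=\eta\wedge\beta\},\quad \Lambda^2_3=\{\beta\mid\ast\beta=-\eta\wedge\beta\},\quad \Lambda^2_4=\{\beta\mid\eta\wedge\beta=0\}.$$ Then $\mathfrak u(2)=\Lambda^2_1\oplus\Lambda^2_3$. The intrinsic torsion with respect to an adapted frame is $\Gamma(X)=\mathrm{pr}_{\mathfrak u(2)^\perp}\big(\Omega^g(X)\big)$, where $\Omega^g=(\omega_{ij})$, $\omega_{ij}=g(\nabla^g e_i,e_j)$, are the connection forms of the Levi-Civita connection. Let $\mathrm{pr}_{\mathcal W}(\alpha\otimes\beta)=\alpha\otimes\mathrm{pr}_{\mathfrak u(2)^\perp}(\beta)$ on $\Lambda^1\otimes\Lambda^2$, let $\theta(\beta)(X,Y,Z)=\ast\beta(X,Y,Z)$, and put $$\mathcal W_3=\mathrm{pr}_{\mathcal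 W}(\theta(\Lambda^2_1)),\quad \mathcal W_4=\mathrm{pr}_{\mathcal W}(\theta(\Lambda^2_2)),\quad \mathcal W_5=\mathrm{pr}_{\mathcal W}(\theta(\Lambda^2_3)),\quad \mathcal W_6=\mathrm{pr}_{\mathcal W}(\theta(\Lambda^2_4)).$$ The manifold is of class $\mathcal W_{i_1}\oplus\dots\oplus\mathcal W_{i_j}$ if $\Gamma\in\mathcal W_{i_1}\oplus\dots\oplus\mathcal W_{i_j}$ at every point (with respect to adapted frames; the spaces are $\mathrm U(2)$-invariant). Call $N$ totally skew-symmetric if $N(X,Y,Z)+N(Y,X,Z)=0$ for all $X,Y,Z$. Then $(M^5,g,\xi,\eta,\varphi)$ is of class a) $\mathcal W_3\oplus\mathcal W_4\oplus\mathcal W_5\oplus\mathcal W_6$ if and only if $N$ is totally skew-symmetric and $\xi$ is a Killing vector field; b) $\mathcal W_3\oplus\mathcal W_5\oplus\mathcal W_6$ if and only if $N$ is totally skew-symmetric and $\xi\lrcorner d\Phi=0$. -/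

import Mathlib

open Set Bundle VectorField
open scoped Manifold ContDiff Matrix

noncomputable section

/-! ### The model space: exterior algebra on `ℝ⁵` with the standard `U(2)`-structure

Forms on `ℝ⁵` are given by their components in the standard basis `e₁, …, e₅` (indices `0, …, 4`):
a 2-form `β` is the skew matrix `β i j = β(e_i, e_j)`, and a tensor `A` in `Λ¹ ⊗ Λ²` is
`A i j k = A(e_i, e_j, e_k)`. In particular `Λ²` is identified with `𝔰𝔬(5)`. -/

namespace ACM

/-- Components of a `(3,0)`-tensor on `ℝ⁵`: `A i` is the bilinear form `A(e_i, ·, ·)`. -/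
abbrev Tensor3 : Type := Fin 5 → Matrix (Fin 5) (Fin 5) ℝ

/-- The space `Λ² = 𝔰𝔬(5)` of 2-forms on `ℝ⁵`. -/
def Lam2 : Submodule ℝ (Matrix (Fin 5) (Fin 5) ℝ) where
  carrier := {β | βᵀ = -β}
  add_mem' := by
    intro a b ha hb
    simp only [Set.mem_ofPred_eq] at *
    rw [Matrix.transpose_add, ha, hb, neg_add]
  zero_mem' := by simp
  smul_mem' := by
    intro c a ha
    simp only [Set.mem_ofPred_eq] at *
    rw [Matrix.transpose_smul, ha, smul_neg]

/-- The inner product `⟨x, y⟩ = -(1/2) tr (x ∘ y)` on `𝔰𝔬(5)`. -/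
def soInner (x y : Matrix (Fin 5) (Fin 5) ℝ) : ℝ := -(1 / 2) * (x * y).trace

/-- The standard fundamental form `Φ = e₁ ∧ e₂ + e₃ ∧ e₄`. -/
def stdPhi : Matrix (Fin 5) (Fin 5) ℝ :=
  !![0, 1, 0, 0, 0; -1, 0, 0, 0, 0; 0, 0, 0, 1, 0; 0, 0, -1, 0, 0; 0, 0, 0, 0, 0]

/-- The standard 1-form `η = e₅`. -/
def stdEta : Fin 5 → ℝ := ![0, 0, 0, 0, 1]

/-- The sign of `b - a`, for indices `a` and `b`. -/
def idxSign (a b : Fin 5) : ℤ := Int.sign ((b : ℤ) - (a : ℤ))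

/-- The Levi-Civita symbol in dimension five: the sign of the permutation `(a, b, c, d, e)` of
the indices, and zero if two of them coincide. -/
def leviCivitaSymbol (a b c d e : Fin 5) : ℤ :=
  idxSign a b * idxSign a c * idxSign a d * idxSign a e * idxSign b c * idxSign b d *
    idxSign b e * idxSign c d * idxSign c e * idxSign d e

/-- The Hodge operator `∗ : Λ² → Λ³` (with `e₁, …, e₅` positively oriented), so that e.g.
`∗(e₁ ∧ e₂) = e₃ ∧ e₄ ∧ e₅`. -/
def hodgeStar : Matrix (Fin 5) (Fin 5) ℝ →ₗ[ℝ] Tensor3 where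
  toFun β := fun i => Matrix.of fun j k =>
    (1 / 2) * ∑ l, ∑ m, (leviCivitaSymbol l m i j k : ℝ) * β l m
  map_add' a b := by
    ext i j k
    simp only [Matrix.add_apply, Matrix.of_apply, Pi.add_apply, mul_add, Finset.sum_add_distrib]
  map_smul' c a := by
    ext i j k
    simp only [Matrix.smul_apply, Matrix.of_apply, Pi.smul_apply, smul_eq_mul, Finset.mul_sum,
      RingHom.id_apply]
    refine Finset.sum_congr rfl fun l _ => Finset.sum_congr rfl fun m _ => ?_
    ring

/-- The wedge product `η ∧ β` of the standard 1-form `η` with a 2-form. -/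
def etaWedge : Matrix (Fin 5) (Fin 5) ℝ →ₗ[ℝ] Tensor3 where
  toFun β := fun i => Matrix.of fun j k =>
    stdEta i * β j k + stdEta j * β k i + stdEta k * β i j
  map_add' a b := by
    ext i j k
    simp only [Matrix.add_apply, Matrix.of_apply, Pi.add_apply]
    ring
  map_smul' c a := by
    ext i j k
    simp only [Matrix.smul_apply, Matrix.of_apply, Pi.smul_apply, smul_eq_mul, RingHom.id_apply]
    ring

/-- The wedge product `Φ ∧ β` of the standard fundamental form with a 2-form. -/
def phiWedge : Matrix (Fin 5) (Fin 5) ℝ →ₗ[ℝ] (Fin 5 → Fin 5 → Fin 5 → Fin 5 → ℝ) where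
  toFun β := fun i j k l =>
    stdPhi i j * β k l - stdPhi i k * β j l + stdPhi i l * β j k
      + stdPhi j k * β i l - stdPhi j l * β i k + stdPhi k l * β i j
  map_add' a b := by
    ext i j k l
    simp only [Matrix.add_apply, Pi.add_apply]
    ring
  map_smul' c a := by
    ext i j k l
    simp only [Matrix.smul_apply, Pi.smul_apply, smul_eq_mul, RingHom.id_apply]
    ring

/-- `Λ²₁ = {t Φ}`. -/
def Lam21 : Submodule ℝ (Matrix (Fin 5) (Fin 5) ℝ) := Submodule.span ℝ {stdPhi}

/-- `Λ²₂ = {β ∈ Λ² | Φ ∧ β = 0, ∗β = η ∧ β}`. -/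
def Lam22 : Submodule ℝ (Matrix (Fin 5) (Fin 5) ℝ) :=
  Lam2 ⊓ LinearMap.ker phiWedge ⊓ LinearMap.eqLocus hodgeStar etaWedge

/-- `Λ²₃ = {β ∈ Λ² | ∗β = - η ∧ β}`. -/
def Lam23 : Submodule ℝ (Matrix (Fin 5) (Fin 5) ℝ) :=
  Lam2 ⊓ LinearMap.eqLocus hodgeStar (-etaWedge)

/-- `Λ²₄ = {β ∈ Λ² | η ∧ β = 0}`. -/
def Lam24 : Submodule ℝ (Matrix (Fin 5) (Fin 5) ℝ) := Lam2 ⊓ LinearMap.ker etaWedge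

/-- The Lie algebra `𝔲(2) = Λ²₁ ⊕ Λ²₃` inside `𝔰𝔬(5) = Λ²`. -/
def u2 : Submodule ℝ (Matrix (Fin 5) (Fin 5) ℝ) := Lam21 ⊔ Lam23

/-- The projection of `𝔰𝔬(5)` onto the orthogonal complement of `𝔲(2)`. Here `Φᵀ Φ` is the
projection of `ℝ⁵` onto `span (e₁, …, e₄)`; that this formula is the orthogonal projection
is the content of `soInner_u2_prU2Perp` and `sub_prU2Perp_mem_u2`. -/
def prU2Perp : Matrix (Fin 5) (Fin 5) ℝ →ₗ[ℝ] Matrix (Fin 5) (Fin 5) ℝ where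
  toFun β := β - (1 / 2 : ℝ) •
    ((stdPhiᵀ * stdPhi) * β * (stdPhiᵀ * stdPhi) + stdPhiᵀ * β * stdPhi)
  map_add' a b := by
    simp only [mul_add, add_mul, smul_add]
    abel
  map_smul' c a := by
    simp only [mul_smul_comm, smul_mul_assoc, RingHom.id_apply, smul_sub, smul_add,
      smul_comm c (1 / 2 : ℝ)]

/-- The projection onto the complement of `𝔲(2)` in components. -/
theorem prU2Perp_apply (β : Matrix (Fin 5) (Fin 5) ℝ) : prU2Perp β =
    !![(β 0 0 - β 1 1) / 2, (β 0 1 + β 1 0) / 2, (β 0 2 - β 1 3) / 2, (β 0 3 + β 1 2) / 2, β 0 4;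
      (β 1 0 + β 0 1) / 2, (β 1 1 - β 0 0) / 2, (β 1 2 + β 0 3) / 2, (β 1 3 - β 0 2) / 2, β 1 4;
      (β 2 0 - β 3 1) / 2, (β 2 1 + β 3 0) / 2, (β 2 2 - β 3 3) / 2, (β 2 3 + β 3 2) / 2, β 2 4;
      (β 3 0 + β 2 1) / 2, (β 3 1 - β 2 0) / 2, (β 3 2 + β 2 3) / 2, (β 3 3 - β 2 2) / 2, β 3 4;
      β 4 0, β 4 1, β 4 2, β 4 3, β 4 4] := by
  have h1 : stdPhiᵀ * stdPhi = Matrix.diagonal ![1, 1, 1, 1, 0] := by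
    ext i j
    fin_cases i <;> fin_cases j <;> simp [stdPhi, Matrix.mul_apply, Fin.sum_univ_succ]
  have h2 : stdPhiᵀ * β * stdPhi =
      !![β 1 1, -β 1 0, β 1 3, -β 1 2, 0; -β 0 1, β 0 0, -β 0 3, β 0 2, 0;
        β 3 1, -β 3 0, β 3 3, -β 3 2, 0; -β 2 1, β 2 0, -β 2 3, β 2 2, 0; 0, 0, 0, 0, 0] := by
    ext i j
    fin_cases i <;> fin_cases j <;> simp [stdPhi, Matrix.mul_apply, Fin.sum_univ_succ]
  simp only [prU2Perp, LinearMap.coe_mk, AddHom.coe_mk, h1, h2]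
  ext i j
  rw [Matrix.sub_apply, Matrix.smul_apply, Matrix.add_apply, Matrix.mul_diagonal,
    Matrix.diagonal_mul]
  fin_cases i <;> fin_cases j <;> simp <;> ring

theorem idxSign_swap (a b : Fin 5) : idxSign b a = -idxSign a b := by
  rw [idxSign, idxSign, ← Int.sign_neg, neg_sub]

theorem hodgeStar_apply (β : Matrix (Fin 5) (Fin 5) ℝ) (i j k : Fin 5) : hodgeStar β i j k =
    (1 / 2) * ∑ l, ∑ m, (leviCivitaSymbol l m i j k : ℝ) * β l m := rfl

theorem etaWedge_apply (β : Matrix (Fin 5) (Fin 5) ℝ) (i j k : Fin 5) : etaWedge β i j k =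
    stdEta i * β j k + stdEta j * β k i + stdEta k * β i j := rfl

theorem hodgeStar_swap₁ (β : Matrix (Fin 5) (Fin 5) ℝ) (i j k : Fin 5) :
    hodgeStar β j i k = -hodgeStar β i j k := by
  have h : ∀ l m, leviCivitaSymbol l m j i k = -leviCivitaSymbol l m i j k := fun l m => by
    simp only [leviCivitaSymbol, idxSign_swap i j]
    ring
  simp only [hodgeStar_apply, h, Int.cast_neg, neg_mul, Finset.sum_neg_distrib, mul_neg]

theorem hodgeStar_swap₂ (β : Matrix (Fin 5) (Fin 5) ℝ) (i j k : Fin 5) :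
    hodgeStar β i k j = -hodgeStar β i j k := by
  have h : ∀ l m, leviCivitaSymbol l m i k j = -leviCivitaSymbol l m i j k := fun l m => by
    simp only [leviCivitaSymbol, idxSign_swap j k]
    ring
  simp only [hodgeStar_apply, h, Int.cast_neg, neg_mul, Finset.sum_neg_distrib, mul_neg]

/-- The ten independent components of `∗β` for a 2-form `β`. -/
theorem hodgeStar_entries {β : Matrix (Fin 5) (Fin 5) ℝ} (hβ : β ∈ Lam2) :
    hodgeStar β 0 1 2 = β 3 4 ∧ hodgeStar β 0 1 3 = -β 2 4 ∧ hodgeStar β 0 1 4 = β 2 3 ∧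
    hodgeStar β 0 2 3 = β 1 4 ∧ hodgeStar β 0 2 4 = -β 1 3 ∧ hodgeStar β 0 3 4 = β 1 2 ∧
    hodgeStar β 1 2 3 = -β 0 4 ∧ hodgeStar β 1 2 4 = β 0 3 ∧ hodgeStar β 1 3 4 = -β 0 2 ∧
    hodgeStar β 2 3 4 = β 0 1 := by
  have hs : ∀ i j, β j i = -β i j := fun i j => congrFun (congrFun (show βᵀ = -β from hβ) i) j
  refine ⟨?_, ?_, ?_, ?_, ?_, ?_, ?_, ?_, ?_, ?_⟩ <;>
    simp [hodgeStar_apply, leviCivitaSymbol, Fin.sum_univ_five, idxSign] <;>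
    norm_num [Int.sign] <;>
    linarith [hs 0 1, hs 0 2, hs 0 3, hs 0 4, hs 1 2, hs 1 3, hs 1 4, hs 2 3, hs 2 4, hs 3 4]

/-- A totally skew-symmetric tensor is determined by its ten independent components. -/
theorem skew3_eq_zero {D : Fin 5 → Fin 5 → Fin 5 → ℝ} (h₁ : ∀ i j k, D j i k = -D i j k)
    (h₂ : ∀ i j k, D i k j = -D i j k) (h : D 0 1 2 = 0 ∧ D 0 1 3 = 0 ∧ D 0 1 4 = 0 ∧
      D 0 2 3 = 0 ∧ D 0 2 4 = 0 ∧ D 0 3 4 = 0 ∧ D 1 2 3 = 0 ∧ D 1 2 4 = 0 ∧ D 1 3 4 = 0 ∧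
      D 2 3 4 = 0) (i j k : Fin 5) : D i j k = 0 := by
  have hlt : ∀ i j k, i < j → j < k → D i j k = 0 := by
    obtain ⟨g0, g1, g2, g3, g4, g5, g6, g7, g8, g9⟩ := h
    intro i j k hij hjk
    fin_cases i <;> fin_cases j <;> first | exact absurd hij (by decide) | skip
    all_goals fin_cases k <;> first | exact absurd hjk (by decide) | assumption
  have d₁ : ∀ i k, D i i k = 0 := fun i k => by linarith [h₁ i i k]
  have d₂ : ∀ i k, D i k k = 0 := fun i k => by linarith [h₂ i k k]
  rcases lt_trichotomy i j with a | a | a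
  · rcases lt_trichotomy j k with b | b | b
    · exact hlt i j k a b
    · rw [b, d₂]
    · rcases lt_trichotomy i k with c | c | c
      · linarith [hlt i k j c b, h₂ i j k]
      · subst c
        linarith [h₂ i j i, h₁ i j i, d₁ i j]
      · linarith [hlt k i j c a, h₂ i j k, h₁ k i j]
  · rw [a, d₁]
  · rcases lt_trichotomy i k with b | b | b
    · linarith [hlt j i k a b, h₁ j i k]
    · rw [b]
      linarith [h₁ j k k, d₂ j k]
    · rcases lt_trichotomy j k with c | c | c
      · linarith [hlt j k i c b, h₁ j i k, h₂ j i k]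
      · rw [c, d₂]
      · linarith [hlt k j i c a, h₁ j i k, h₂ j i k, h₁ k j i]

theorem mem_Lam23_iff {x : Matrix (Fin 5) (Fin 5) ℝ} : x ∈ Lam23 ↔ x ∈ Lam2 ∧
    (x 0 4 = 0 ∧ x 1 4 = 0 ∧ x 2 4 = 0 ∧ x 3 4 = 0) ∧
      x 2 3 = -x 0 1 ∧ x 1 3 = x 0 2 ∧ x 1 2 = -x 0 3 := by
  have hη : stdEta 0 = 0 ∧ stdEta 1 = 0 ∧ stdEta 2 = 0 ∧ stdEta 3 = 0 ∧ stdEta 4 = 1 := by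
    simp [stdEta]
  obtain ⟨q0, q1, q2, q3, q4⟩ := hη
  constructor
  · rintro ⟨h, h'⟩
    have hs : ∀ i j, x j i = -x i j := fun i j => congrFun (congrFun (show xᵀ = -x from h) i) j
    have hh : ∀ i j k, hodgeStar x i j k = -etaWedge x i j k := fun i j k =>
      congrFun (congrFun (congrFun (show hodgeStar x = (-etaWedge) x from h') i) j) k
    obtain ⟨e0, e1, e2, e3, e4, e5, e6, e7, e8, e9⟩ := hodgeStar_entries h
    rw [hh, etaWedge_apply] at e0 e1 e2 e3 e4 e5 e6 e7 e8 e9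
    simp only [q0, q1, q2, q3, q4] at e0 e1 e2 e3 e4 e5 e6 e7 e8 e9
    refine ⟨h, ⟨?_, ?_, ?_, ?_⟩, ?_, ?_, ?_⟩ <;> linarith
  · rintro ⟨h, ⟨z0, z1, z2, z3⟩, a, b, c⟩
    have hs : ∀ i j, x j i = -x i j := fun i j => congrFun (congrFun (show xᵀ = -x from h) i) j
    refine ⟨h, ?_⟩
    change hodgeStar x = (-etaWedge) x
    ext i j k
    rw [← sub_eq_zero]
    refine skew3_eq_zero (D := fun i j k => hodgeStar x i j k - (-etaWedge) x i j k)
      (fun i j k => ?_) (fun i j k => ?_) ?_ i j k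
    · have := hodgeStar_swap₁ x i j k
      simp only [LinearMap.neg_apply, Pi.neg_apply, Matrix.neg_apply, etaWedge_apply]
      rw [this, hs i j, hs j k, hs k i]
      ring
    · have := hodgeStar_swap₂ x i j k
      simp only [LinearMap.neg_apply, Pi.neg_apply, Matrix.neg_apply, etaWedge_apply]
      rw [this, hs i j, hs j k, hs k i]
      ring
    · obtain ⟨e0, e1, e2, e3, e4, e5, e6, e7, e8, e9⟩ := hodgeStar_entries h
      simp only [LinearMap.neg_apply, Pi.neg_apply, Matrix.neg_apply, etaWedge_apply, e0, e1, e2,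
        e3, e4, e5, e6, e7, e8, e9, q0, q1, q2, q3, q4]
      refine ⟨?_, ?_, ?_, ?_, ?_, ?_, ?_, ?_, ?_, ?_⟩ <;>
        linarith [hs 0 2, hs 0 3, hs 1 3, hs 0 1, hs 1 2, hs 2 3, hs 0 4, hs 1 4]

theorem stdPhi_mem_Lam2 : stdPhi ∈ Lam2 := by
  change stdPhiᵀ = -stdPhi
  ext i j
  fin_cases i <;> fin_cases j <;> simp [stdPhi]

/-- The projection takes `Λ²` to itself. -/
theorem prU2Perp_mem_Lam2 {β : Matrix (Fin 5) (Fin 5) ℝ} (hβ : β ∈ Lam2) : prU2Perp β ∈ Lam2 := by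
  have h : βᵀ = -β := hβ
  change (prU2Perp β)ᵀ = - prU2Perp β
  simp only [prU2Perp, LinearMap.coe_mk, AddHom.coe_mk, Matrix.transpose_sub,
    Matrix.transpose_smul, Matrix.transpose_add, Matrix.transpose_mul, Matrix.transpose_transpose,
    h, Matrix.mul_neg, Matrix.neg_mul, Matrix.mul_assoc]
  module

/-- The complementary component of the projection lies in `𝔲(2)`. -/
theorem sub_prU2Perp_mem_u2 {β : Matrix (Fin 5) (Fin 5) ℝ} (hβ : β ∈ Lam2) :
    β - prU2Perp β ∈ u2 := by
  have hs : ∀ i j, β j i = -β i j := fun i j => congrFun (congrFun (show βᵀ = -β from hβ) i) j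
  have hsplit : β - prU2Perp β = ((β 0 1 + β 2 3) / 2) • stdPhi +
      (β - prU2Perp β - ((β 0 1 + β 2 3) / 2) • stdPhi) := by abel
  rw [hsplit]
  refine Submodule.add_mem_sup
    (Submodule.smul_mem _ _ (Submodule.mem_span_singleton_self _)) (mem_Lam23_iff.2 ⟨?_, ?_⟩)
  · exact Lam2.sub_mem (Lam2.sub_mem hβ (prU2Perp_mem_Lam2 hβ)) (Lam2.smul_mem _ stdPhi_mem_Lam2)
  · rw [prU2Perp_apply]
    simp only [Matrix.sub_apply, Matrix.smul_apply]
    refine ⟨⟨?_, ?_, ?_, ?_⟩, ?_, ?_, ?_⟩ <;> simp [stdPhi] <;>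
      linarith [hs 0 1, hs 0 2, hs 0 3, hs 1 2, hs 1 3, hs 2 3]

theorem prU2Perp_of_mem_u2 {x : Matrix (Fin 5) (Fin 5) ℝ} (hx : x ∈ u2) : prU2Perp x = 0 := by
  have key : ∀ y ∈ Lam2, y 0 4 = 0 → y 1 4 = 0 → y 2 4 = 0 → y 3 4 = 0 → y 1 3 = y 0 2 →
      y 1 2 = -y 0 3 → prU2Perp y = 0 := by
    intro y h z0 z1 z2 z3 a b
    have hs : ∀ i j, y j i = -y i j := fun i j => congrFun (congrFun (show yᵀ = -y from h) i) j
    rw [prU2Perp_apply]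
    ext i j
    fin_cases i <;> fin_cases j <;> simp <;>
      linarith [hs 0 0, hs 1 1, hs 2 2, hs 3 3, hs 4 4, hs 0 1, hs 0 2, hs 0 3, hs 0 4, hs 1 2,
        hs 1 3, hs 1 4, hs 2 3, hs 2 4, hs 3 4]
  have : u2 ≤ LinearMap.ker prU2Perp := by
    refine sup_le ?_ fun y hy => ?_
    · rw [Lam21, Submodule.span_singleton_le_iff_mem, LinearMap.mem_ker]
      apply key _ stdPhi_mem_Lam2 <;> simp [stdPhi]
    · obtain ⟨h, ⟨z0, z1, z2, z3⟩, -, a, b⟩ := mem_Lam23_iff.1 hy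
      exact key y h z0 z1 z2 z3 a b
  exact this hx

/-- The image of the projection is orthogonal to `𝔲(2)`. -/
theorem soInner_u2_prU2Perp {x : Matrix (Fin 5) (Fin 5) ℝ} (hx : x ∈ u2)
    (β : Matrix (Fin 5) (Fin 5) ℝ) : soInner x (prU2Perp β) = 0 := by
  have h : soInner x (prU2Perp β) = soInner (prU2Perp x) β := by
    rw [prU2Perp_apply, prU2Perp_apply]
    simp [soInner, Matrix.trace, Matrix.mul_apply, Fin.sum_univ_five, Matrix.vecMul, dotProduct]
    ring
  rw [h, prU2Perp_of_mem_u2 hx]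
  simp [soInner]

/-- The projection `pr_W : Λ¹ ⊗ Λ² → W = Λ¹ ⊗ 𝔲(2)^⊥`, `α ⊗ β ↦ α ⊗ pr β`. -/
def prW : Tensor3 →ₗ[ℝ] Tensor3 where
  toFun A := fun i => prU2Perp (A i)
  map_add' a b := by
    ext1 i
    simp only [Pi.add_apply, map_add]
  map_smul' c a := by
    ext1 i
    simp only [Pi.smul_apply, map_smul, RingHom.id_apply]

/-- `θ : Λ² → Λ¹ ⊗ Λ²`, `θ(β)(X, Y, Z) = ∗β(X, Y, Z)`. -/
def theta : Matrix (Fin 5) (Fin 5) ℝ →ₗ[ℝ] Tensor3 := hodgeStar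

/-- The module `W₃ = pr_W(θ(Λ²₁))`. -/
def W3 : Submodule ℝ Tensor3 := Lam21.map (prW ∘ₗ theta)

/-- The module `W₄ = pr_W(θ(Λ²₂))`. -/
def W4 : Submodule ℝ Tensor3 := Lam22.map (prW ∘ₗ theta)

/-- The module `W₅ = pr_W(θ(Λ²₃))`. -/
def W5 : Submodule ℝ Tensor3 := Lam23.map (prW ∘ₗ theta)

/-- The module `W₆ = pr_W(θ(Λ²₄))`. -/
def W6 : Submodule ℝ Tensor3 := Lam24.map (prW ∘ₗ theta)

/-! ### Almost contact metric 5-manifolds -/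

/-- The model space of 5-manifolds. -/
abbrev E5 : Type := EuclideanSpace ℝ (Fin 5)

section Manifold

variable {M : Type*} [TopologicalSpace M] [ChartedSpace E5 M]

/-- The vector field `X` is smooth on the set `U`. -/
def SmoothFieldOn [IsManifold (𝓡 5) ∞ M] (X : Π p : M, TangentSpace (𝓡 5) p) (U : Set M) : Prop :=
  ContMDiffOn (𝓡 5) (𝓡 5).tangent ∞ (fun p => (⟨p, X p⟩ : TangentBundle (𝓡 5) M)) U

/-- The derivative `X(f)` of a function in the direction of a vector field. -/
def dirDeriv (X : Π p : M, TangentSpace (𝓡 5) p) (f : M → ℝ) (p : M) : ℝ :=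
  mvfderiv (𝓡 5) f p (X p)

end Manifold

/-- An almost contact metric structure `(g, ξ, η, φ)` on a smooth 5-manifold; the 1-form `η`
is the metric dual of `ξ`, see `AlmostContactMetric.eta`. -/
structure AlmostContactMetric (M : Type*) [TopologicalSpace M] [ChartedSpace E5 M]
    [IsManifold (𝓡 5) ∞ M] where
  /-- the Riemannian metric -/
  g : ContMDiffRiemannianMetric (𝓡 5) ∞ E5 (fun p : M => TangentSpace (𝓡 5) p)
  /-- the vector field of length one -/
  ξ : Π p : M, TangentSpace (𝓡 5) p
  /-- the endomorphism of the tangent bundle -/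
  φ : Π p : M, TangentSpace (𝓡 5) p →L[ℝ] TangentSpace (𝓡 5) p
  smooth_ξ : SmoothFieldOn ξ univ
  smooth_φ : ContMDiff (𝓡 5) ((𝓡 5).prod 𝓘(ℝ, E5 →L[ℝ] E5)) ∞
    (fun p => TotalSpace.mk' (E5 →L[ℝ] E5)
      (E := fun p : M => TangentSpace (𝓡 5) p →L[ℝ] TangentSpace (𝓡 5) p) p (φ p))
  unit_ξ : ∀ p, g.inner p (ξ p) (ξ p) = 1
  φ_ξ : ∀ p, φ p (ξ p) = 0
  φ_φ : ∀ p (v : TangentSpace (𝓡 5) p), φ p (φ p v) = -v + g.inner p (ξ p) v • ξ p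
  compat : ∀ p (v w : TangentSpace (𝓡 5) p),
    g.inner p (φ p v) (φ p w) = g.inner p v w - g.inner p (ξ p) v * g.inner p (ξ p) w

namespace AlmostContactMetric

variable {M : Type*} [TopologicalSpace M] [ChartedSpace E5 M] [IsManifold (𝓡 5) ∞ M]
  (S : AlmostContactMetric M)

/-- The function `g(X, Y)`. -/
def met (X Y : Π p : M, TangentSpace (𝓡 5) p) (p : M) : ℝ := S.g.inner p (X p) (Y p)

/-- The 1-form `η = g(ξ, ·)`, as the function `η(X)`. -/
def eta (X : Π p : M, TangentSpace (𝓡 5) p) (p : M) : ℝ := S.g.inner p (S.ξ p) (X p)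

/-- The vector field `φ(X)`. -/
def phi (X : Π p : M, TangentSpace (𝓡 5) p) (p : M) : TangentSpace (𝓡 5) p := S.φ p (X p)

/-- The fundamental form `Φ(X, Y) = g(X, φ(Y))`. -/
def Phi (X Y : Π p : M, TangentSpace (𝓡 5) p) (p : M) : ℝ := S.g.inner p (X p) (S.φ p (Y p))

/-- The exterior derivative `dη(X, Y) = X(η(Y)) - Y(η(X)) - η([X, Y])`. -/
def dEta (X Y : Π p : M, TangentSpace (𝓡 5) p) (p : M) : ℝ :=
  dirDeriv X (S.eta Y) p - dirDeriv Y (S.eta X) p - S.eta (mlieBracket (𝓡 5) X Y) p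

/-- The exterior derivative `dΦ(X, Y, Z)`, the cyclic sum of `X(Φ(Y, Z)) - Φ([X, Y], Z)`. -/
def dPhi (X Y Z : Π p : M, TangentSpace (𝓡 5) p) (p : M) : ℝ :=
  dirDeriv X (S.Phi Y Z) p + dirDeriv Y (S.Phi Z X) p + dirDeriv Z (S.Phi X Y) p
    - S.Phi (mlieBracket (𝓡 5) X Y) Z p - S.Phi (mlieBracket (𝓡 5) Y Z) X p
    - S.Phi (mlieBracket (𝓡 5) Z X) Y p

/-- The Nijenhuis torsion
`[φ, φ](X, Y) = [φX, φY] + φ²[X, Y] - φ[φX, Y] - φ[X, φY]`. -/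
def nijenhuisTorsion (X Y : Π p : M, TangentSpace (𝓡 5) p) (p : M) : TangentSpace (𝓡 5) p :=
  mlieBracket (𝓡 5) (S.phi X) (S.phi Y) p + S.φ p (S.φ p (mlieBracket (𝓡 5) X Y p))
    - S.φ p (mlieBracket (𝓡 5) (S.phi X) Y p) - S.φ p (mlieBracket (𝓡 5) X (S.phi Y) p)

/-- The Nijenhuis tensor `N(X, Y, Z) = g(X, [φ, φ](Y, Z)) + η(X) dη(Y, Z)`. -/
def nijenhuis (X Y Z : Π p : M, TangentSpace (𝓡 5) p) (p : M) : ℝ :=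
  S.met X (S.nijenhuisTorsion Y Z) p + S.eta X p * S.dEta Y Z p

/-- `N` is totally skew-symmetric: `N(X, Y, Z) + N(Y, X, Z) = 0` (the skew-symmetry in the last
two arguments is automatic). Tensorial identities are tested on all local vector fields. -/
def NijenhuisTotallySkew : Prop :=
  ∀ U : Set M, IsOpen U → ∀ X Y Z : Π p : M, TangentSpace (𝓡 5) p,
    SmoothFieldOn X U → SmoothFieldOn Y U → SmoothFieldOn Z U →
      ∀ p ∈ U, S.nijenhuis X Y Z p + S.nijenhuis Y X Z p = 0

/-- `ξ` is a Killing vector field: the Lie derivative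
`(L_ξ g)(X, Y) = ξ(g(X, Y)) - g([ξ, X], Y) - g(X, [ξ, Y])` vanishes. -/
def IsKilling : Prop :=
  ∀ U : Set M, IsOpen U → ∀ X Y : Π p : M, TangentSpace (𝓡 5) p,
    SmoothFieldOn X U → SmoothFieldOn Y U → ∀ p ∈ U,
      dirDeriv S.ξ (S.met X Y) p - S.met (mlieBracket (𝓡 5) S.ξ X) Y p
        - S.met X (mlieBracket (𝓡 5) S.ξ Y) p = 0

/-- `ξ ⌟ dΦ = 0`. -/
def ContractionDPhiVanishes : Prop :=
  ∀ U : Set M, IsOpen U → ∀ X Y : Π p : M, TangentSpace (𝓡 5) p,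
    SmoothFieldOn X U → SmoothFieldOn Y U → ∀ p ∈ U, S.dPhi S.ξ X Y p = 0

/-- The function `g(∇_X Y, Z)` for the Levi-Civita connection `∇` of `g`, defined by Koszul's
formula; see `lcInner_eq` for the agreement with any metric torsion-free connection. -/
def lcInner (X Y Z : Π p : M, TangentSpace (𝓡 5) p) (p : M) : ℝ :=
  (1 / 2) * (dirDeriv X (S.met Y Z) p + dirDeriv Y (S.met Z X) p - dirDeriv Z (S.met X Y) p
    + S.met (mlieBracket (𝓡 5) X Y) Z p - S.met (mlieBracket (𝓡 5) Y Z) X p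
    + S.met (mlieBracket (𝓡 5) Z X) Y p)

/-- Koszul's formula computes `g(∇_X Y, Z)` for every covariant derivative on the tangent bundle
that is torsion-free and compatible with `g`. -/
theorem lcInner_eq (cov : CovariantDerivative (𝓡 5) E5 (fun p : M => TangentSpace (𝓡 5) p))
    (htor : cov.torsion = 0)
    (hmet : ∀ X Y Z : Π p : M, TangentSpace (𝓡 5) p, ∀ p,
      MDifferentiableAt (𝓡 5) (𝓡 5).tangent (fun q => (⟨q, Y q⟩ : TangentBundle (𝓡 5) M)) p →
      MDifferentiableAt (𝓡 5) (𝓡 5).tangent (fun q => (⟨q, Z q⟩ : TangentBundle (𝓡 5) M)) p →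
      dirDeriv X (S.met Y Z) p =
        S.g.inner p (cov Y p (X p)) (Z p) + S.g.inner p (Y p) (cov Z p (X p)))
    {U : Set M} (hU : IsOpen U) {X Y Z : Π p : M, TangentSpace (𝓡 5) p}
    (hX : SmoothFieldOn X U) (hY : SmoothFieldOn Y U) (hZ : SmoothFieldOn Z U)
    {p : M} (hp : p ∈ U) : S.lcInner X Y Z p = S.g.inner p (cov Y p (X p)) (Z p) := by
  have hd : ∀ {V : Π p : M, TangentSpace (𝓡 5) p}, SmoothFieldOn V U →
      MDifferentiableAt (𝓡 5) (𝓡 5).tangent (fun q => (⟨q, V q⟩ : TangentBundle (𝓡 5) M)) p :=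
    fun hV => (ContMDiffOn.contMDiffAt (n := ∞) hV (hU.mem_nhds hp)).mdifferentiableAt (by simp)
  have hXY := cov.torsion_eq_zero_iff.1 htor (hd hX) (hd hY)
  have hYZ := cov.torsion_eq_zero_iff.1 htor (hd hY) (hd hZ)
  have hZX := cov.torsion_eq_zero_iff.1 htor (hd hZ) (hd hX)
  simp only [lcInner]
  rw [hmet X Y Z p (hd hY) (hd hZ), hmet Y Z X p (hd hZ) (hd hX), hmet Z X Y p (hd hX) (hd hY)]
  simp only [met, ← hXY, ← hYZ, ← hZX, map_sub, sub_apply]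
  rw [S.g.symm p (Y p) (cov Z p (X p)), S.g.symm p (Z p) (cov X p (Y p)),
    S.g.symm p (X p) (cov Y p (Z p))]
  ring

/-- `(e₁, …, e₅)` is an adapted frame on `U`: a smooth orthonormal frame such that
`Φ = e₁ ∧ e₂ + e₃ ∧ e₄` and `η = e₅`. (It is positively oriented, the orientation being the one
defined by `η ∧ Φ²`.) Adapted frames exist near every point. -/
structure IsAdaptedFrameOn (e : Fin 5 → Π p : M, TangentSpace (𝓡 5) p) (U : Set M) : Prop where
  smooth : ∀ i, SmoothFieldOn (e i) U
  orthonormal : ∀ p ∈ U, ∀ i j, S.met (e i) (e j) p = if i = j then 1 else 0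
  Phi_eq : ∀ p ∈ U, ∀ i j, S.Phi (e i) (e j) p = stdPhi i j
  eta_eq : ∀ p ∈ U, ∀ i, S.eta (e i) p = stdEta i

/-- The `𝔰𝔬(5)`-valued connection 1-form `Ω = (ω_ij)`, `ω_ij = g(∇ e_i, e_j)`, of the Levi-Civita
connection with respect to the frame `e`; the entry `k` is the value of `Ω` on `e_k`. -/
def connectionForm (e : Fin 5 → Π p : M, TangentSpace (𝓡 5) p) (p : M) : Tensor3 :=
  fun k => Matrix.of fun i j => S.lcInner (e k) (e i) (e j) p

/-- The intrinsic torsion `Γ(X) = pr_{𝔲(2)^⊥}(Ω(X))` with respect to the adapted frame `e`. -/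
def intrinsicTorsion (e : Fin 5 → Π p : M, TangentSpace (𝓡 5) p) (p : M) : Tensor3 :=
  fun k => prU2Perp (S.connectionForm e p k)

/-- The structure is of class `W` if `Γ ∈ W` at every point. The modules in question are
`U(2)`-invariant, so that the choice of the adapted frame does not matter. -/
def IsOfClass (W : Submodule ℝ Tensor3) : Prop :=
  ∀ U : Set M, IsOpen U → ∀ e : Fin 5 → Π p : M, TangentSpace (𝓡 5) p,
    S.IsAdaptedFrameOn e U → ∀ p ∈ U, S.intrinsicTorsion e p ∈ W

end AlmostContactMetric

end ACM

end

/-! Everything is reduced to linear algebra in the connection coefficients `A k i j = g(∇_{e_k} e_i,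
e_j)` of an adapted frame, where index 4 is the direction of ξ.

Algebraic side: Λ² is the sum of the four Λ²ᵢ, so W₃ ⊕ W₄ ⊕ W₅ ⊕ W₆ is the image of all of Λ², and Γ
lies in it iff A agrees modulo 𝔲(2) with some 3-form T = ∗β. Modulo 𝔲(2) a 2-form retains only its
entries `β i 4` and the combinations `β 0 2 - β 1 3`, `β 0 3 + β 1 2` (`prU2Perp_eq_iff`).
Eliminating T leaves the equations `IsSkewTorsionType`. Omitting W₄ restricts β to the complement of
Λ²₂, which adds two equations (`prW_mem_W3456_iff`, `prW_mem_W356_iff`).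

Geometric side: g, Φ and η have constant components in an adapted frame, so the derivative terms
vanish, and torsion-freeness gives `g([e_i, e_j], e_k) = A i j k - A j i k`. Hence N, L_ξ g and ξ ⌟
dΦ are linear in A (`nijenhuis_frame`, `lieDerivMet_frame`, `dPhi_xi_frame`). By tensoriality and
the local existence of adapted frames, each condition is equivalent to its frame version.

It remains to compare linear systems. Skewness of N yields every equation of `IsSkewTorsionType`
except part of the skewness of `A i j 4` in i, j. The Killing condition is exactly that skewness,
giving a). The equation ξ ⌟ dΦ = 0 supplies the missing part and also annihilates the W₄-component,
giving b). -/

namespace ACM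

open scoped Topology

/-! ### Directional derivatives and differentiable vector fields. -/

section DirectionalDerivative

variable {M : Type*} [TopologicalSpace M] [ChartedSpace E5 M]

/-- The vector field `X` is differentiable at `p`. -/
abbrev DiffFieldAt [IsManifold (𝓡 5) ∞ M] (X : Π p : M, TangentSpace (𝓡 5) p) (p : M) : Prop :=
  MDifferentiableAt (𝓡 5) (𝓡 5).tangent (fun q => (⟨q, X q⟩ : TangentBundle (𝓡 5) M)) p

theorem dirDeriv_mul (X : Π p : M, TangentSpace (𝓡 5) p) {f h : M → ℝ} {p : M}
    (hf : MDifferentiableAt (𝓡 5) 𝓘(ℝ) f p) (hh : MDifferentiableAt (𝓡 5) 𝓘(ℝ) h p) :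
    dirDeriv X (f * h) p = f p * dirDeriv X h p + h p * dirDeriv X f p := by
  simp only [dirDeriv, mvfderiv_mul hf hh]
  rfl

theorem dirDeriv_add (X : Π p : M, TangentSpace (𝓡 5) p) {f h : M → ℝ} {p : M}
    (hf : MDifferentiableAt (𝓡 5) 𝓘(ℝ) f p) (hh : MDifferentiableAt (𝓡 5) 𝓘(ℝ) h p) :
    dirDeriv X (f + h) p = dirDeriv X f p + dirDeriv X h p := by
  simp only [dirDeriv, mvfderiv_add hf hh]
  rfl

theorem dirDeriv_smul_left (X : Π p : M, TangentSpace (𝓡 5) p) (f h : M → ℝ) (p : M) :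
    dirDeriv (f • X) h p = f p * dirDeriv X h p := by
  simp [dirDeriv]

theorem dirDeriv_add_left (X Y : Π p : M, TangentSpace (𝓡 5) p) (h : M → ℝ) (p : M) :
    dirDeriv (X + Y) h p = dirDeriv X h p + dirDeriv Y h p := by
  simp [dirDeriv]

/-- Applied to the components of g, Φ and η in an adapted frame, this removes all derivative terms
from Koszul's formula, dη, L_ξ g and ξ ⌟ dΦ. -/
theorem dirDeriv_of_eqOn_const (X : Π p : M, TangentSpace (𝓡 5) p) {f : M → ℝ} {c : ℝ} {U : Set M}
    (hU : IsOpen U) (h : ∀ q ∈ U, f q = c) {p : M} (hp : p ∈ U) : dirDeriv X f p = 0 := by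
  have h' : f =ᶠ[𝓝 p] fun _ => c := Filter.eventuallyEq_of_mem (hU.mem_nhds hp) h
  have h0 : mfderiv (𝓡 5) 𝓘(ℝ) f p = 0 := h'.mfderiv_eq.trans mfderiv_const
  simp only [dirDeriv, mvfderiv, h0]
  simp

theorem dirDeriv_zero (X : Π p : M, TangentSpace (𝓡 5) p) (p : M) :
    dirDeriv X (0 : M → ℝ) p = 0 :=
  dirDeriv_of_eqOn_const X isOpen_univ (c := 0) (fun _ _ => rfl) (mem_univ p)

variable [IsManifold (𝓡 5) ∞ M]

theorem SmoothFieldOn.mdifferentiableAt {X : Π p : M, TangentSpace (𝓡 5) p} {U : Set M}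
    (hX : SmoothFieldOn X U) (hU : IsOpen U) {p : M} (hp : p ∈ U) : DiffFieldAt X p :=
  (ContMDiffOn.contMDiffAt (n := ∞) hX (hU.mem_nhds hp)).mdifferentiableAt (by simp)

theorem SmoothFieldOn.mono {X : Π p : M, TangentSpace (𝓡 5) p} {U V : Set M}
    (hX : SmoothFieldOn X U) (h : V ⊆ U) : SmoothFieldOn X V :=
  ContMDiffOn.mono hX h

end DirectionalDerivative

/-! ### Regularity and pointwise algebra of the structure tensors. -/

namespace AlmostContactMetric

variable {M : Type*} [TopologicalSpace M] [ChartedSpace E5 M] [IsManifold (𝓡 5) ∞ M]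
  (S : AlmostContactMetric M)

theorem mdifferentiableAt_met {X Y : Π p : M, TangentSpace (𝓡 5) p} {p : M}
    (hX : DiffFieldAt X p) (hY : DiffFieldAt Y p) : MDifferentiableAt (𝓡 5) 𝓘(ℝ) (S.met X Y) p := by
  have h := MDifferentiableAt.clm_bundle_apply₂ (E₃ := Bundle.Trivial M ℝ) (F₃ := ℝ)
    (S.g.contMDiff.contMDiffAt (x := p) |>.mdifferentiableAt (by simp)) hX hY
  simp only [mdifferentiableAt_totalSpace] at h
  exact h.2

theorem mdifferentiableAt_phi {X : Π p : M, TangentSpace (𝓡 5) p} {p : M}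
    (hX : DiffFieldAt X p) : DiffFieldAt (S.phi X) p :=
  MDifferentiableAt.clm_bundle_apply
    (S.smooth_φ.contMDiffAt (x := p) |>.mdifferentiableAt (by simp)) hX

theorem mdifferentiableAt_xi (p : M) : DiffFieldAt S.ξ p :=
  S.smooth_ξ.mdifferentiableAt isOpen_univ (mem_univ p)

theorem mdifferentiableAt_eta {X : Π p : M, TangentSpace (𝓡 5) p} {p : M}
    (hX : DiffFieldAt X p) : MDifferentiableAt (𝓡 5) 𝓘(ℝ) (S.eta X) p :=
  S.mdifferentiableAt_met (S.mdifferentiableAt_xi p) hX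

theorem mdifferentiableAt_Phi {X Y : Π p : M, TangentSpace (𝓡 5) p} {p : M}
    (hX : DiffFieldAt X p) (hY : DiffFieldAt Y p) : MDifferentiableAt (𝓡 5) 𝓘(ℝ) (S.Phi X Y) p :=
  S.mdifferentiableAt_met hX (S.mdifferentiableAt_phi hY)

theorem contMDiffOn_met {X Y : Π p : M, TangentSpace (𝓡 5) p} {U : Set M}
    (hX : SmoothFieldOn X U) (hY : SmoothFieldOn Y U) :
    ContMDiffOn (𝓡 5) 𝓘(ℝ) ∞ (S.met X Y) U := by
  have h := ContMDiffOn.clm_bundle_apply₂ (E₃ := Bundle.Trivial M ℝ) (F₃ := ℝ)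
    (S.g.contMDiff.contMDiffOn (s := U)) hX hY
  intro q hq
  have := h q hq
  simp only [Bundle.contMDiffWithinAt_totalSpace] at this
  exact this.2

theorem smoothFieldOn_phi {X : Π p : M, TangentSpace (𝓡 5) p} {U : Set M}
    (hX : SmoothFieldOn X U) : SmoothFieldOn (S.phi X) U :=
  ContMDiffOn.clm_bundle_apply (S.smooth_φ.contMDiffOn (s := U)) hX

/-- Compute φ³v in two ways: φ²(φv) = -φv + η(φv)ξ, while φ(φ²v) = -φv because φξ = 0. So η(φv)ξ =
0, and ξ has length one. -/
theorem eta_phi (p : M) (v : TangentSpace (𝓡 5) p) : S.g.inner p (S.ξ p) (S.φ p v) = 0 := by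
  have h1 := S.φ_φ p (S.φ p v)
  have h2 := congrArg (S.φ p) (S.φ_φ p v)
  rw [map_add, map_neg, map_smul, S.φ_ξ, smul_zero, add_zero, h1] at h2
  have h3 := congrArg (S.g.inner p (S.ξ p)) (add_eq_left.1 h2)
  simpa [S.unit_ξ] using h3

theorem inner_phi_left (p : M) (v w : TangentSpace (𝓡 5) p) :
    S.g.inner p (S.φ p v) w = -S.g.inner p v (S.φ p w) := by
  have h := S.compat p v (S.φ p w)
  rw [S.φ_φ, S.eta_phi] at h
  simp only [map_add, map_neg, map_smul, smul_eq_mul, mul_zero, sub_zero] at h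
  rw [S.g.symm p (S.φ p v) (S.ξ p), S.eta_phi] at h
  linarith

theorem met_comm (X Y : Π p : M, TangentSpace (𝓡 5) p) : S.met X Y = S.met Y X :=
  funext fun _ => S.g.symm _ _ _

theorem met_smul_left (f : M → ℝ) (X Y : Π p : M, TangentSpace (𝓡 5) p) :
    S.met (f • X) Y = f * S.met X Y := by
  funext p
  simp [met]

theorem met_add_left (X X' Y : Π p : M, TangentSpace (𝓡 5) p) :
    S.met (X + X') Y = S.met X Y + S.met X' Y := by
  funext p
  simp [met]

theorem eta_smul (f : M → ℝ) (X : Π p : M, TangentSpace (𝓡 5) p) :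
    S.eta (f • X) = f * S.eta X := by
  funext p
  simp [eta]

theorem eta_add (X Y : Π p : M, TangentSpace (𝓡 5) p) :
    S.eta (X + Y) = S.eta X + S.eta Y := by
  funext p
  simp [eta]

theorem phi_smul (f : M → ℝ) (X : Π p : M, TangentSpace (𝓡 5) p) :
    S.phi (f • X) = f • S.phi X := by
  funext p
  simp [phi]

theorem phi_add (X Y : Π p : M, TangentSpace (𝓡 5) p) :
    S.phi (X + Y) = S.phi X + S.phi Y := by
  funext p
  simp [phi]

theorem Phi_smul_left (f : M → ℝ) (X Y : Π p : M, TangentSpace (𝓡 5) p) :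
    S.Phi (f • X) Y = f * S.Phi X Y := by
  funext p
  simp [Phi]

theorem Phi_smul_right (f : M → ℝ) (X Y : Π p : M, TangentSpace (𝓡 5) p) :
    S.Phi X (f • Y) = f * S.Phi X Y := by
  funext p
  simp [Phi]

theorem Phi_add_left (X X' Y : Π p : M, TangentSpace (𝓡 5) p) :
    S.Phi (X + X') Y = S.Phi X Y + S.Phi X' Y := by
  funext p
  simp [Phi]

theorem Phi_add_right (X Y Y' : Π p : M, TangentSpace (𝓡 5) p) :
    S.Phi X (Y + Y') = S.Phi X Y + S.Phi X Y' := by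
  funext p
  simp [Phi]

theorem Phi_swap (X Y : Π p : M, TangentSpace (𝓡 5) p) (p : M) : S.Phi Y X p = -S.Phi X Y p := by
  simp only [Phi]
  rw [← S.inner_phi_left, S.g.symm]

/-! ### Tensoriality -/

/-- The term Z(f)η(Y) from the product rule cancels against the one produced by [fY, Z] = f[Y, Z] -
Z(f)Y. -/
theorem tensorialAt_dEta {p : M} (Z : Π p : M, TangentSpace (𝓡 5) p) :
    TensorialAt (𝓡 5) E5 (fun Y : Π p : M, TangentSpace (𝓡 5) p => S.dEta Y Z p) p where
  smul {f Y} hf hY := by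
    simp only [dEta, S.eta_smul, dirDeriv_smul_left, dirDeriv_mul _ hf (S.mdifferentiableAt_eta hY)]
    simp only [eta, mlieBracket_smul_left hf hY, map_add, map_smul, smul_eq_mul, map_neg,
      neg_smul, dirDeriv]
    ring
  add {Y Y'} hY hY' := by
    simp only [dEta, S.eta_add, dirDeriv_add_left, dirDeriv_add _ (S.mdifferentiableAt_eta hY)
      (S.mdifferentiableAt_eta hY')]
    simp only [eta, mlieBracket_add_left hY hY', map_add]
    ring

/-- Derivatives of f cancel in pairs: (φZ)(f)φY between the first and last bracket, Z(f)φ²Y between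
the two middle ones. -/
theorem tensorialAt_nijenhuisTorsion {p : M} (Z : Π p : M, TangentSpace (𝓡 5) p) :
    TensorialAt (𝓡 5) E5
      (fun Y : Π p : M, TangentSpace (𝓡 5) p => S.nijenhuisTorsion Y Z p) p where
  smul {f Y} hf hY := by
    simp only [nijenhuisTorsion, S.phi_smul, mlieBracket_smul_left hf hY,
      mlieBracket_smul_left hf (S.mdifferentiableAt_phi hY), map_add, map_smul, neg_smul, map_neg,
      smul_add, smul_sub]
    simp only [phi]
    module
  add {Y Y'} hY hY' := by
    simp only [nijenhuisTorsion, S.phi_add, mlieBracket_add_left hY hY',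
      mlieBracket_add_left (S.mdifferentiableAt_phi hY) (S.mdifferentiableAt_phi hY'), map_add]
    abel

theorem nijenhuis_swap (X Y Z : Π p : M, TangentSpace (𝓡 5) p) (p : M) :
    S.nijenhuis X Z Y p = -S.nijenhuis X Y Z p := by
  simp only [nijenhuis, met, nijenhuisTorsion, dEta, eta]
  rw [mlieBracket_swap_apply (V := Z), mlieBracket_swap_apply (V := S.phi Z) (W := S.phi Y),
    mlieBracket_swap_apply (V := S.phi Z) (W := Y), mlieBracket_swap_apply (V := Z) (W := S.phi Y)]
  simp only [map_add, map_sub, map_neg]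
  ring

theorem tensorialAt_nijenhuis₁ {p : M} (Y Z : Π p : M, TangentSpace (𝓡 5) p) :
    TensorialAt (𝓡 5) E5 (fun X : Π p : M, TangentSpace (𝓡 5) p => S.nijenhuis X Y Z p) p where
  smul _ _ := by
    simp only [nijenhuis, S.met_smul_left, S.eta_smul, Pi.mul_apply, smul_eq_mul]
    ring
  add _ _ := by
    simp only [nijenhuis, S.met_add_left, S.eta_add, Pi.add_apply]
    ring

theorem tensorialAt_nijenhuis₂ {p : M} (X Z : Π p : M, TangentSpace (𝓡 5) p) :
    TensorialAt (𝓡 5) E5 (fun Y : Π p : M, TangentSpace (𝓡 5) p => S.nijenhuis X Y Z p) p where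
  smul hf hY := by
    simp only [nijenhuis, (S.tensorialAt_dEta Z).smul hf hY, met,
      (S.tensorialAt_nijenhuisTorsion Z).smul hf hY, map_smul, smul_eq_mul]
    ring
  add hY hY' := by
    simp only [nijenhuis, (S.tensorialAt_dEta Z).add hY hY', met,
      (S.tensorialAt_nijenhuisTorsion Z).add hY hY', map_add]
    ring

theorem tensorialAt_nijenhuis₃ {p : M} (X Y : Π p : M, TangentSpace (𝓡 5) p) :
    TensorialAt (𝓡 5) E5 (fun Z : Π p : M, TangentSpace (𝓡 5) p => S.nijenhuis X Y Z p) p where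
  smul hf hZ := by
    rw [S.nijenhuis_swap, (S.tensorialAt_nijenhuis₂ X Y).smul hf hZ, S.nijenhuis_swap X Y]
    simp
  add hZ hZ' := by
    rw [S.nijenhuis_swap, (S.tensorialAt_nijenhuis₂ X Y).add hZ hZ', S.nijenhuis_swap X Y,
      S.nijenhuis_swap X Y]
    ring

/-- The Lie derivative `(L_ξ g)(X, Y)`. -/
noncomputable def lieDerivMet (X Y : Π p : M, TangentSpace (𝓡 5) p) (p : M) : ℝ :=
  dirDeriv S.ξ (S.met X Y) p - S.met (mlieBracket (𝓡 5) S.ξ X) Y p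
    - S.met X (mlieBracket (𝓡 5) S.ξ Y) p

theorem lieDerivMet_comm (X Y : Π p : M, TangentSpace (𝓡 5) p) (p : M) :
    S.lieDerivMet X Y p = S.lieDerivMet Y X p := by
  simp only [lieDerivMet, S.met_comm X, S.met_comm _ Y]
  ring

theorem tensorialAt_lieDerivMet₁ {p : M} {Y : Π p : M, TangentSpace (𝓡 5) p}
    (hY : DiffFieldAt Y p) :
    TensorialAt (𝓡 5) E5 (fun X : Π p : M, TangentSpace (𝓡 5) p => S.lieDerivMet X Y p) p where
  smul {f X} hf hX := by
    simp only [lieDerivMet, S.met_smul_left, dirDeriv_mul _ hf (S.mdifferentiableAt_met hX hY),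
      Pi.mul_apply]
    simp only [met, mlieBracket_smul_right hf hX, map_add, map_smul, add_apply, smul_apply,
      smul_eq_mul, dirDeriv]
    ring
  add {X X'} hX hX' := by
    simp only [lieDerivMet, S.met_add_left, dirDeriv_add _ (S.mdifferentiableAt_met hX hY)
      (S.mdifferentiableAt_met hX' hY), Pi.add_apply]
    simp only [met, mlieBracket_add_right hX hX', map_add, add_apply]
    ring

theorem tensorialAt_lieDerivMet₂ {p : M} {X : Π p : M, TangentSpace (𝓡 5) p}
    (hX : DiffFieldAt X p) :
    TensorialAt (𝓡 5) E5 (fun Y : Π p : M, TangentSpace (𝓡 5) p => S.lieDerivMet X Y p) p := by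
  simp only [S.lieDerivMet_comm X]
  exact S.tensorialAt_lieDerivMet₁ hX

theorem Phi_xi_right (X : Π p : M, TangentSpace (𝓡 5) p) : S.Phi X S.ξ = 0 := by
  funext p
  simp [Phi, S.φ_ξ]

theorem Phi_xi_left (X : Π p : M, TangentSpace (𝓡 5) p) : S.Phi S.ξ X = 0 := by
  funext p
  simp [Phi, S.eta_phi]

/-- The contraction `ξ ⌟ dΦ` is the Lie derivative of `Φ` in the direction of `ξ`. -/
theorem dPhi_xi (X Y : Π p : M, TangentSpace (𝓡 5) p) (p : M) : S.dPhi S.ξ X Y p =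
    dirDeriv S.ξ (S.Phi X Y) p - S.Phi (mlieBracket (𝓡 5) S.ξ X) Y p
      + S.Phi (mlieBracket (𝓡 5) S.ξ Y) X p := by
  simp only [dPhi, S.Phi_xi_left, S.Phi_xi_right, dirDeriv_zero, Pi.zero_apply]
  simp only [Phi, mlieBracket_swap_apply (V := Y) (W := S.ξ), map_neg, neg_apply]
  ring

theorem dPhi_xi_swap (X Y : Π p : M, TangentSpace (𝓡 5) p) (p : M) :
    S.dPhi S.ξ Y X p = -S.dPhi S.ξ X Y p := by
  have h : dirDeriv S.ξ (S.Phi Y X) p = -dirDeriv S.ξ (S.Phi X Y) p := by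
    have : S.Phi Y X = -S.Phi X Y := funext fun q => S.Phi_swap X Y q
    rw [this, dirDeriv, mvfderiv_neg]
    rfl
  rw [S.dPhi_xi, S.dPhi_xi, h]
  ring

theorem tensorialAt_dPhi_xi₁ {p : M} {Y : Π p : M, TangentSpace (𝓡 5) p}
    (hY : DiffFieldAt Y p) :
    TensorialAt (𝓡 5) E5 (fun X : Π p : M, TangentSpace (𝓡 5) p => S.dPhi S.ξ X Y p) p where
  smul {f X} hf hX := by
    simp only [S.dPhi_xi, S.Phi_smul_left, S.Phi_smul_right,
      dirDeriv_mul _ hf (S.mdifferentiableAt_Phi hX hY), Pi.mul_apply]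
    simp only [Phi, mlieBracket_smul_right hf hX, map_add, map_smul, add_apply, smul_apply,
      smul_eq_mul, dirDeriv]
    ring
  add {X X'} hX hX' := by
    simp only [S.dPhi_xi, S.Phi_add_left, S.Phi_add_right,
      dirDeriv_add _ (S.mdifferentiableAt_Phi hX hY) (S.mdifferentiableAt_Phi hX' hY),
      Pi.add_apply]
    simp only [Phi, mlieBracket_add_right hX hX', map_add, add_apply]
    ring

theorem tensorialAt_dPhi_xi₂ {p : M} {X : Π p : M, TangentSpace (𝓡 5) p}
    (hX : DiffFieldAt X p) :
    TensorialAt (𝓡 5) E5 (fun Y : Π p : M, TangentSpace (𝓡 5) p => S.dPhi S.ξ X Y p) p where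
  smul hf hY := by
    rw [S.dPhi_xi_swap, (S.tensorialAt_dPhi_xi₁ hX).smul hf hY, S.dPhi_xi_swap X]
    simp
  add hY hY' := by
    rw [S.dPhi_xi_swap, (S.tensorialAt_dPhi_xi₁ hX).add hY hY', S.dPhi_xi_swap X,
      S.dPhi_xi_swap X]
    ring

end AlmostContactMetric

end ACM

namespace ACM

/-! ### The modules `W₃ ⊕ W₄ ⊕ W₅ ⊕ W₆` and `W₃ ⊕ W₅ ⊕ W₆` in components -/

theorem Lam2_swap {β : Matrix (Fin 5) (Fin 5) ℝ} (hβ : β ∈ Lam2) (i j : Fin 5) :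
    β j i = -β i j :=
  congrFun (congrFun (show βᵀ = -β from hβ) i) j

theorem Lam2_diag {β : Matrix (Fin 5) (Fin 5) ℝ} (hβ : β ∈ Lam2) (i : Fin 5) : β i i = 0 := by
  linarith [Lam2_swap hβ i i]

theorem etaWedge_swap₁ {β : Matrix (Fin 5) (Fin 5) ℝ} (hβ : β ∈ Lam2) (i j k : Fin 5) :
    etaWedge β j i k = -etaWedge β i j k := by
  rw [etaWedge_apply, etaWedge_apply, Lam2_swap hβ i j, Lam2_swap hβ k i, Lam2_swap hβ j k]
  ring

theorem etaWedge_swap₂ {β : Matrix (Fin 5) (Fin 5) ℝ} (hβ : β ∈ Lam2) (i j k : Fin 5) :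
    etaWedge β i k j = -etaWedge β i j k := by
  rw [etaWedge_apply, etaWedge_apply, Lam2_swap hβ i j, Lam2_swap hβ k i, Lam2_swap hβ j k]
  ring

/-- The ten independent components of `η ∧ β` for a 2-form `β`. -/
theorem etaWedge_entries (β : Matrix (Fin 5) (Fin 5) ℝ) :
    etaWedge β 0 1 2 = 0 ∧ etaWedge β 0 1 3 = 0 ∧ etaWedge β 0 1 4 = β 0 1 ∧
    etaWedge β 0 2 3 = 0 ∧ etaWedge β 0 2 4 = β 0 2 ∧ etaWedge β 0 3 4 = β 0 3 ∧
    etaWedge β 1 2 3 = 0 ∧ etaWedge β 1 2 4 = β 1 2 ∧ etaWedge β 1 3 4 = β 1 3 ∧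
    etaWedge β 2 3 4 = β 2 3 := by
  simp [etaWedge_apply, stdEta]

theorem mem_Lam24 {β : Matrix (Fin 5) (Fin 5) ℝ} (hβ : β ∈ Lam2)
    (h : β 0 1 = 0 ∧ β 0 2 = 0 ∧ β 0 3 = 0 ∧ β 1 2 = 0 ∧ β 1 3 = 0 ∧ β 2 3 = 0) : β ∈ Lam24 := by
  refine ⟨hβ, LinearMap.mem_ker.2 ?_⟩
  ext i j k
  refine skew3_eq_zero (etaWedge_swap₁ hβ) (etaWedge_swap₂ hβ) ?_ i j k
  simpa [etaWedge_entries β] using h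

/-- The generic element of `Λ²₂`. -/
def lam22Form (x y : ℝ) : Matrix (Fin 5) (Fin 5) ℝ :=
  !![0, 0, x, y, 0; 0, 0, y, -x, 0; -x, -y, 0, 0, 0; -y, x, 0, 0, 0; 0, 0, 0, 0, 0]

theorem lam22Form_mem_Lam2 (x y : ℝ) : lam22Form x y ∈ Lam2 := by
  change (lam22Form x y)ᵀ = -lam22Form x y
  ext i j
  fin_cases i <;> fin_cases j <;> simp [lam22Form]

theorem phiWedge_lam22Form (x y : ℝ) : phiWedge (lam22Form x y) = 0 := by
  -- Integer tables for Φ and for the coefficients of x and y make the vanishing of all components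
  -- decidable.
  let P : Fin 5 → Fin 5 → ℤ := ![![0, 1, 0, 0, 0], ![-1, 0, 0, 0, 0], ![0, 0, 0, 1, 0],
    ![0, 0, -1, 0, 0], ![0, 0, 0, 0, 0]]
  let F : Fin 5 → Fin 5 → ℤ := ![![0, 0, 1, 0, 0], ![0, 0, 0, -1, 0], ![-1, 0, 0, 0, 0],
    ![0, 1, 0, 0, 0], ![0, 0, 0, 0, 0]]
  let G : Fin 5 → Fin 5 → ℤ := ![![0, 0, 0, 1, 0], ![0, 0, 1, 0, 0], ![0, -1, 0, 0, 0],
    ![-1, 0, 0, 0, 0], ![0, 0, 0, 0, 0]]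
  have hP : ∀ i j, stdPhi i j = P i j := by
    intro i j
    fin_cases i <;> fin_cases j <;> simp [stdPhi, P]
  have hFG : ∀ i j, lam22Form x y i j = x * F i j + y * G i j := by
    intro i j
    fin_cases i <;> fin_cases j <;> simp [lam22Form, F, G]
  have hF : ∀ i j k l, P i j * F k l - P i k * F j l + P i l * F j k + P j k * F i l
      - P j l * F i k + P k l * F i j = 0 := by
    decide
  have hG : ∀ i j k l, P i j * G k l - P i k * G j l + P i l * G j k + P j k * G i l
      - P j l * G i k + P k l * G i j = 0 := by
    decide
  ext i j k l
  have h1 : (P i j * F k l - P i k * F j l + P i l * F j k + P j k * F i l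
      - P j l * F i k + P k l * F i j : ℝ) = 0 := mod_cast hF i j k l
  have h2 : (P i j * G k l - P i k * G j l + P i l * G j k + P j k * G i l
      - P j l * G i k + P k l * G i j : ℝ) = 0 := mod_cast hG i j k l
  simp only [phiWedge, LinearMap.coe_mk, AddHom.coe_mk, hP, hFG, Pi.zero_apply]
  linear_combination x * h1 + y * h2

theorem lam22Form_mem_Lam22 (x y : ℝ) : lam22Form x y ∈ Lam22 := by
  have h := lam22Form_mem_Lam2 x y
  refine ⟨⟨h, LinearMap.mem_ker.2 (phiWedge_lam22Form x y)⟩, ?_⟩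
  change hodgeStar _ = etaWedge _
  ext i j k
  rw [← sub_eq_zero]
  refine skew3_eq_zero
    (D := fun i j k => hodgeStar (lam22Form x y) i j k - etaWedge (lam22Form x y) i j k)
    (fun i j k => ?_) (fun i j k => ?_) ?_ i j k
  · rw [hodgeStar_swap₁, etaWedge_swap₁ h]
    ring
  · rw [hodgeStar_swap₂, etaWedge_swap₂ h]
    ring
  · simp only [hodgeStar_entries h, etaWedge_entries _]
    simp [lam22Form]

/-- The two equations say that the coordinates `(β 0 2 - β 1 3) / 2` and `(β 0 3 + β 1 2) / 2` along
Λ²₂ vanish. -/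
theorem mem_Lam21_sup_Lam23_sup_Lam24_iff {β : Matrix (Fin 5) (Fin 5) ℝ} :
    β ∈ Lam21 ⊔ Lam23 ⊔ Lam24 ↔ β ∈ Lam2 ∧ β 1 3 = β 0 2 ∧ β 1 2 = -β 0 3 := by
  constructor
  · let L : Submodule ℝ (Matrix (Fin 5) (Fin 5) ℝ) :=
      { carrier := {β | β ∈ Lam2 ∧ β 1 3 = β 0 2 ∧ β 1 2 = -β 0 3}
        add_mem' := by
          rintro a b ⟨ha, ha', ha''⟩ ⟨hb, hb', hb''⟩
          refine ⟨Lam2.add_mem ha hb, ?_, ?_⟩ <;> simp only [Matrix.add_apply] <;> linarith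
        zero_mem' := ⟨Lam2.zero_mem, by simp, by simp⟩
        smul_mem' := by
          rintro c a ⟨ha, ha', ha''⟩
          refine ⟨Lam2.smul_mem c ha, ?_, ?_⟩ <;> simp [ha', ha''] }
    have h : Lam21 ⊔ Lam23 ⊔ Lam24 ≤ L := by
      refine sup_le (sup_le ?_ ?_) ?_
      · rw [Lam21, Submodule.span_singleton_le_iff_mem]
        exact ⟨stdPhi_mem_Lam2, by simp [stdPhi], by simp [stdPhi]⟩
      · intro x hx
        obtain ⟨h, -, -, h1, h2⟩ := mem_Lam23_iff.1 hx
        exact ⟨h, h1, h2⟩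
      · rintro x ⟨h, hx⟩
        have hx' : etaWedge x = 0 := hx
        obtain ⟨-, -, -, -, e1, e2, -, e3, e4, -⟩ := etaWedge_entries _
        rw [hx'] at e1 e2 e3 e4
        simp only [Pi.zero_apply, Matrix.zero_apply] at e1 e2 e3 e4
        exact ⟨h, by linarith, by linarith⟩
    exact fun hβ => h hβ
  · rintro ⟨h, h1, h2⟩
    -- γ is the part of β divisible by η, hence in Λ²₄. Removing the mean of `β 0 1` and `β 2 3` as
    -- a multiple of Φ makes the rest anti-self-dual.
    let γ : Matrix (Fin 5) (Fin 5) ℝ := !![0, 0, 0, 0, β 0 4; 0, 0, 0, 0, β 1 4; 0, 0, 0, 0, β 2 4;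
      0, 0, 0, 0, β 3 4; -β 0 4, -β 1 4, -β 2 4, -β 3 4, 0]
    have hγ : γ ∈ Lam2 := by
      change γᵀ = -γ
      ext i j
      fin_cases i <;> fin_cases j <;> simp [γ]
    have hsplit : β = ((β 0 1 + β 2 3) / 2) • stdPhi
        + (β - ((β 0 1 + β 2 3) / 2) • stdPhi - γ) + γ := by abel
    rw [hsplit]
    refine Submodule.add_mem_sup (Submodule.add_mem_sup
      (Submodule.smul_mem _ _ (Submodule.mem_span_singleton_self _)) (mem_Lam23_iff.2 ⟨?_, ?_⟩))
      (mem_Lam24 hγ (by simp [γ]))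
    · exact Lam2.sub_mem (Lam2.sub_mem h (Lam2.smul_mem _ stdPhi_mem_Lam2)) hγ
    · refine ⟨⟨?_, ?_, ?_, ?_⟩, ?_, ?_, ?_⟩ <;> simp [stdPhi, γ] <;> linarith

theorem Lam2_eq_sup : Lam21 ⊔ Lam22 ⊔ Lam23 ⊔ Lam24 = Lam2 := by
  refine le_antisymm (sup_le (sup_le (sup_le ?_ ?_) ?_) ?_) fun β hβ => ?_
  · rw [Lam21, Submodule.span_singleton_le_iff_mem]
    exact stdPhi_mem_Lam2
  · exact fun x hx => hx.1.1
  · exact fun x hx => hx.1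
  · exact fun x hx => hx.1
  · have h : β - lam22Form ((β 0 2 - β 1 3) / 2) ((β 0 3 + β 1 2) / 2) ∈
        Lam21 ⊔ Lam23 ⊔ Lam24 := by
      refine mem_Lam21_sup_Lam23_sup_Lam24_iff.2
        ⟨Lam2.sub_mem hβ (lam22Form_mem_Lam2 _ _), ?_, ?_⟩ <;> simp [lam22Form] <;> ring
    have h' := Submodule.add_mem_sup h (lam22Form_mem_Lam22 ((β 0 2 - β 1 3) / 2)
      ((β 0 3 + β 1 2) / 2))
    rw [sub_add_cancel] at h'
    refine (le_of_eq ?_ : Lam21 ⊔ Lam23 ⊔ Lam24 ⊔ Lam22 ≤ Lam21 ⊔ Lam22 ⊔ Lam23 ⊔ Lam24) h'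
    ac_rfl

/-- The listed quantities are six independent coordinates on the complement of 𝔲(2), which has
dimension 10 - 4. -/
theorem prU2Perp_eq_iff {β γ : Matrix (Fin 5) (Fin 5) ℝ} (hβ : β ∈ Lam2) (hγ : γ ∈ Lam2) :
    prU2Perp β = prU2Perp γ ↔ (∀ i, β i 4 = γ i 4) ∧
      β 0 2 - β 1 3 = γ 0 2 - γ 1 3 ∧ β 0 3 + β 1 2 = γ 0 3 + γ 1 2 := by
  constructor
  · intro h
    have h' : ∀ i j, prU2Perp β i j = prU2Perp γ i j := fun i j => by rw [h]
    rw [prU2Perp_apply, prU2Perp_apply] at h'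
    refine ⟨fun i => ?_, ?_, ?_⟩
    · have := h' i 4
      fin_cases i <;> simpa using this
    · have := h' 0 2
      simp at this
      linarith
    · have := h' 0 3
      simp at this
      linarith
  · rintro ⟨h0, h1, h2⟩
    rw [← sub_eq_zero, ← map_sub]
    have hd : β - γ ∈ Lam2 := Lam2.sub_mem hβ hγ
    have hs := Lam2_swap hd
    have e : ∀ i, (β - γ) i 4 = 0 := fun i => sub_eq_zero.2 (h0 i)
    have e1 : (β - γ) 1 3 = (β - γ) 0 2 := by
      simp only [Matrix.sub_apply]
      linarith
    have e2 : (β - γ) 1 2 = -(β - γ) 0 3 := by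
      simp only [Matrix.sub_apply]
      linarith
    generalize β - γ = δ at hd hs e e1 e2
    rw [prU2Perp_apply]
    ext i j
    fin_cases i <;> fin_cases j <;> simp <;>
      linarith [hs 0 0, hs 1 1, hs 2 2, hs 3 3, hs 0 1, hs 0 2, hs 0 3, hs 0 4, hs 1 2,
        hs 1 3, hs 1 4, hs 2 3, hs 2 4, hs 3 4, e 0, e 1, e 2, e 3, e 4]

theorem hodgeStar_apply_mem_Lam2 (β : Matrix (Fin 5) (Fin 5) ℝ) (k : Fin 5) :
    hodgeStar β k ∈ Lam2 := by
  change (hodgeStar β k)ᵀ = -hodgeStar β k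
  ext i j
  exact hodgeStar_swap₂ β k i j

/-- The linear equations for the connection forms `A` which express that their projection lies
in `W₃ ⊕ W₄ ⊕ W₅ ⊕ W₆`. -/
structure IsSkewTorsionType (A : Tensor3) : Prop where
  skew : ∀ i j, A i j 4 = -A j i 4
  four_sub : A 4 0 2 - A 4 1 3 = A 0 2 4 - A 1 3 4
  four_add : A 4 0 3 + A 4 1 2 = A 0 3 4 + A 1 2 4
  zero_one_sub : A 0 0 2 - A 0 1 3 = A 1 0 3 + A 1 1 2
  zero_one_add : A 0 0 3 + A 0 1 2 = -(A 1 0 2 - A 1 1 3)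
  two_three_sub : A 2 0 2 - A 2 1 3 = A 3 0 3 + A 3 1 2
  two_three_add : A 2 0 3 + A 2 1 2 = -(A 3 0 2 - A 3 1 3)

theorem prW_mem_map_iff {A : Tensor3} (hA : ∀ k, A k ∈ Lam2)
    (L : Submodule ℝ (Matrix (Fin 5) (Fin 5) ℝ)) : prW A ∈ L.map (prW ∘ₗ theta) ↔
      ∃ β ∈ L, (∀ k i, hodgeStar β k i 4 = A k i 4) ∧
        (∀ k, hodgeStar β k 0 2 - hodgeStar β k 1 3 = A k 0 2 - A k 1 3) ∧
        ∀ k, hodgeStar β k 0 3 + hodgeStar β k 1 2 = A k 0 3 + A k 1 2 := by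
  rw [Submodule.mem_map]
  refine exists_congr fun β => and_congr_right fun _ => ?_
  rw [← forall_and, ← forall_and, LinearMap.comp_apply, theta, funext_iff]
  exact forall_congr' fun k => prU2Perp_eq_iff (hodgeStar_apply_mem_Lam2 β k) (hA k)

/-- Each equation arises because one component of the 3-form T = ∗β is visible through several first
indices. For instance `T 0 1 3` appears in `T 0 0 2 - T 0 1 3` and, up to sign, in `T 1 0 3 + T 1 1
2`. -/
theorem isSkewTorsionType_of_hodgeStar {A : Tensor3} {β : Matrix (Fin 5) (Fin 5) ℝ}
    (h : (∀ k i, hodgeStar β k i 4 = A k i 4) ∧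
        (∀ k, hodgeStar β k 0 2 - hodgeStar β k 1 3 = A k 0 2 - A k 1 3) ∧
        ∀ k, hodgeStar β k 0 3 + hodgeStar β k 1 2 = A k 0 3 + A k 1 2) :
    IsSkewTorsionType A := by
  obtain ⟨h0, h1, h2⟩ := h
  have s₁ := hodgeStar_swap₁ β
  have s₂ := hodgeStar_swap₂ β
  have d₁ : ∀ i k, hodgeStar β i i k = 0 := fun i k => by linarith [s₁ i i k]
  have d₂ : ∀ i k, hodgeStar β i k k = 0 := fun i k => by linarith [s₂ i k k]
  have d₃ : ∀ i k, hodgeStar β i k i = 0 := fun i k => by linarith [s₁ i k i, d₂ k i]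
  refine ⟨fun i j => ?_, ?_, ?_, ?_, ?_, ?_, ?_⟩
  · rw [← h0, ← h0, s₁]
  · linarith [h1 4, h0 0 2, h0 1 3, s₁ 0 4 2, s₂ 0 2 4, s₁ 1 4 3, s₂ 1 3 4]
  · linarith [h2 4, h0 0 3, h0 1 2, s₁ 0 4 3, s₂ 0 3 4, s₁ 1 4 2, s₂ 1 2 4]
  · linarith [h1 0, h2 1, d₁ 0 2, s₁ 0 1 3, d₁ 1 2]
  · linarith [h2 0, h1 1, d₁ 0 3, s₁ 0 1 2, d₁ 1 3]
  · linarith [h1 2, h2 3, d₃ 2 0, s₁ 1 2 3, d₃ 3 0, s₁ 1 3 2, s₂ 1 2 3]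
  · linarith [h2 2, h1 3, d₃ 2 1, s₁ 0 2 3, d₃ 3 1, s₁ 0 3 2, s₂ 0 2 3]

/-- The 2-form whose Hodge dual has the same projection as the connection forms `A` in the case
of skew-symmetric torsion. -/
def torsionForm (A : Tensor3) : Matrix (Fin 5) (Fin 5) ℝ :=
  !![0, A 2 3 4, -A 1 3 4, A 1 2 4, -(A 2 0 2 - A 2 1 3);
    -A 2 3 4, 0, A 0 3 4, -A 0 2 4, -(A 2 0 3 + A 2 1 2);
    A 1 3 4, -A 0 3 4, 0, A 0 1 4, A 0 0 2 - A 0 1 3;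
    -A 1 2 4, A 0 2 4, -A 0 1 4, 0, A 0 0 3 + A 0 1 2;
    A 2 0 2 - A 2 1 3, A 2 0 3 + A 2 1 2, -(A 0 0 2 - A 0 1 3), -(A 0 0 3 + A 0 1 2), 0]

theorem torsionForm_mem_Lam2 (A : Tensor3) : torsionForm A ∈ Lam2 := by
  change (torsionForm A)ᵀ = -torsionForm A
  ext i j
  fin_cases i <;> fin_cases j <;> simp [torsionForm]

/-- The witness solves for the ten components of T: those containing index 4 are `A i j 4`, and the
other four are read off the projection equations with first index 0 and 2. The equations with first
index 1, 3 and 4 are then the compatibility conditions in `IsSkewTorsionType`. -/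
theorem hodgeStar_torsionForm {A : Tensor3} (hA : ∀ k, A k ∈ Lam2) (h : IsSkewTorsionType A) :
    (∀ k i, hodgeStar (torsionForm A) k i 4 = A k i 4) ∧
      (∀ k, hodgeStar (torsionForm A) k 0 2 - hodgeStar (torsionForm A) k 1 3
        = A k 0 2 - A k 1 3) ∧
      ∀ k, hodgeStar (torsionForm A) k 0 3 + hodgeStar (torsionForm A) k 1 2
        = A k 0 3 + A k 1 2 := by
  have s₁ := hodgeStar_swap₁ (torsionForm A)
  have s₂ := hodgeStar_swap₂ (torsionForm A)
  have d₁ : ∀ i k, hodgeStar (torsionForm A) i i k = 0 := fun i k => by linarith [s₁ i i k]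
  have d₂ : ∀ i k, hodgeStar (torsionForm A) i k k = 0 := fun i k => by linarith [s₂ i k k]
  have d₃ : ∀ i k, hodgeStar (torsionForm A) i k i = 0 := fun i k => by
    linarith [s₁ i k i, d₂ k i]
  obtain ⟨e0, e1, e2, e3, e4, e5, e6, e7, e8, e9⟩ := hodgeStar_entries (torsionForm_mem_Lam2 A)
  generalize hodgeStar (torsionForm A) = T at *
  simp [torsionForm] at e0 e1 e2 e3 e4 e5 e6 e7 e8 e9
  obtain ⟨k, f1, f2, z1, z2, t1, t2⟩ := h
  have a4 : ∀ i, A i 4 4 = 0 := fun i => Lam2_diag (hA i) 4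
  have a0 : ∀ i, A i i 4 = 0 := fun i => by linarith [k i i]
  have a1 : ∀ i, A 4 i 4 = 0 := fun i => by linarith [k 4 i, a4 i]
  refine ⟨fun i j => ?_, fun i => ?_, fun i => ?_⟩
  · have key : ∀ i j, i < j → T i j 4 = A i j 4 := by
      intro i j hij
      fin_cases i <;> fin_cases j <;> first | exact absurd hij (by decide) | skip
      all_goals first | assumption | exact (d₂ _ _).trans (a4 _).symm
    rcases lt_trichotomy i j with hij | rfl | hij
    · exact key i j hij
    · rw [d₁, a0]
    · rw [s₁, k, key j i hij]
  · fin_cases i <;> simp only [Fin.zero_eta, Fin.mk_one, Fin.reduceFinMk]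
    · linarith [d₁ 0 2]
    · linarith [s₁ 0 1 2, d₁ 1 3]
    · linarith [d₃ 2 0, s₁ 1 2 3]
    · linarith [d₃ 3 1, s₁ 0 3 2, s₂ 0 2 3]
    · linarith [s₁ 0 4 2, s₂ 0 2 4, s₁ 1 4 3, s₂ 1 3 4]
  · fin_cases i <;> simp only [Fin.zero_eta, Fin.mk_one, Fin.reduceFinMk]
    · linarith [d₁ 0 3]
    · linarith [s₁ 0 1 3, d₁ 1 2]
    · linarith [d₃ 2 1, s₁ 0 2 3]
    · linarith [d₃ 3 0, s₁ 1 3 2, s₂ 1 2 3]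
    · linarith [s₁ 0 4 3, s₂ 0 3 4, s₁ 1 4 2, s₂ 1 2 4]

theorem prW_mem_W3456_iff {A : Tensor3} (hA : ∀ k, A k ∈ Lam2) :
    prW A ∈ W3 ⊔ W4 ⊔ W5 ⊔ W6 ↔ IsSkewTorsionType A := by
  rw [W3, W4, W5, W6, ← Submodule.map_sup, ← Submodule.map_sup, ← Submodule.map_sup, Lam2_eq_sup,
    prW_mem_map_iff hA]
  exact ⟨fun ⟨β, _, h⟩ => isSkewTorsionType_of_hodgeStar h,
    fun h => ⟨torsionForm A, torsionForm_mem_Lam2 A, hodgeStar_torsionForm hA h⟩⟩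

/-- Under the Hodge operator the two equations defining the complement of Λ²₂ become equations on `T
i j 4`, and these components of T coincide with `A i j 4`. -/
theorem prW_mem_W356_iff {A : Tensor3} (hA : ∀ k, A k ∈ Lam2) :
    prW A ∈ W3 ⊔ W5 ⊔ W6 ↔ IsSkewTorsionType A ∧ A 0 2 4 = A 1 3 4 ∧ A 0 3 4 = -A 1 2 4 := by
  rw [W3, W5, W6, ← Submodule.map_sup, ← Submodule.map_sup, prW_mem_map_iff hA]
  constructor
  · rintro ⟨β, hβ, h⟩
    obtain ⟨hβ2, b1, b2⟩ := mem_Lam21_sup_Lam23_sup_Lam24_iff.1 hβ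
    obtain ⟨-, -, -, -, e4, e5, -, e7, e8, -⟩ := hodgeStar_entries hβ2
    refine ⟨isSkewTorsionType_of_hodgeStar h, ?_, ?_⟩ <;> simp only [← h.1] <;> linarith
  · rintro ⟨h, h1, h2⟩
    refine ⟨torsionForm A, mem_Lam21_sup_Lam23_sup_Lam24_iff.2 ⟨torsionForm_mem_Lam2 A, ?_, ?_⟩,
      hodgeStar_torsionForm hA h⟩ <;> simp [torsionForm] <;> linarith

end ACM

namespace ACM

/-! ### The conditions in an adapted frame -/

/-- The permutation `J` of the indices with `φ e_j = ± e_{J j}` for `j = 1, …, 4`. -/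
def phiIdx : Fin 5 → Fin 5 := ![1, 0, 3, 2, 4]

/-- The signs `s` with `φ e_j = s_j e_{J j}`. -/
def phiSign : Fin 5 → ℝ := ![-1, 1, -1, 1, 0]

/-- The component `g([e_i, e_j], e_k)` in terms of the connection forms. -/
def bracketComp (A : Tensor3) (i j k : Fin 5) : ℝ := A i j k - A j i k

/-- The component `N(e_i, e_j, e_k)` of the Nijenhuis tensor in an adapted frame. -/
def nijenhuisComp (A : Tensor3) (i j k : Fin 5) : ℝ :=
  phiSign j * phiSign k * bracketComp A (phiIdx j) (phiIdx k) i - bracketComp A j k i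
    + phiSign i * phiSign j * bracketComp A (phiIdx j) k (phiIdx i)
    + phiSign i * phiSign k * bracketComp A j (phiIdx k) (phiIdx i)

/-- The component `dΦ(ξ, e_i, e_j)` in an adapted frame. -/
def dPhiXiComp (A : Tensor3) (i j : Fin 5) : ℝ :=
  -(phiSign j * bracketComp A 4 i (phiIdx j)) - phiSign i * bracketComp A j 4 (phiIdx i)

theorem nijenhuisComp_of_isSkewTorsionType {A : Tensor3} (hA : ∀ k, A k ∈ Lam2)
    (h : IsSkewTorsionType A) (i j k : Fin 5) :
    nijenhuisComp A i j k + nijenhuisComp A j i k = 0 := by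
  have d : ∀ k i, A k i i = 0 := fun k i => Lam2_diag (hA k) i
  have a10 : ∀ k, A k 1 0 = -A k 0 1 := fun k => Lam2_swap (hA k) 0 1
  have a20 : ∀ k, A k 2 0 = -A k 0 2 := fun k => Lam2_swap (hA k) 0 2
  have a30 : ∀ k, A k 3 0 = -A k 0 3 := fun k => Lam2_swap (hA k) 0 3
  have a21 : ∀ k, A k 2 1 = -A k 1 2 := fun k => Lam2_swap (hA k) 1 2
  have a31 : ∀ k, A k 3 1 = -A k 1 3 := fun k => Lam2_swap (hA k) 1 3
  have a32 : ∀ k, A k 3 2 = -A k 2 3 := fun k => Lam2_swap (hA k) 2 3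
  have a4 : ∀ k i, A k 4 i = -A k i 4 := fun k i => Lam2_swap (hA k) i 4
  obtain ⟨s, f1, f2, z1, z2, t1, t2⟩ := h
  have s0 : ∀ i, A i i 4 = 0 := fun i => by linarith [s i i]
  have s1 : ∀ i, A 4 i 4 = 0 := fun i => by linarith [s 4 i, d i 4]
  have s10 := s 1 0
  have s20 := s 2 0
  have s30 := s 3 0
  have s21 := s 2 1
  have s31 := s 3 1
  have s32 := s 3 2
  -- The rules above bring A to independent entries: last two indices increasing, and `A i j 4` with
  -- i < j.
  fin_cases i <;> fin_cases j <;> fin_cases k <;>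
    simp [nijenhuisComp, bracketComp, phiSign, phiIdx, d, a10, a20, a30, a21, a31, a32, a4, s0, s1,
      s10, s20, s30, s21, s31, s32] <;> linarith

theorem dPhiXiComp_of_isSkewTorsionType {A : Tensor3} (hA : ∀ k, A k ∈ Lam2)
    (h : IsSkewTorsionType A) (h1 : A 0 2 4 = A 1 3 4) (h2 : A 0 3 4 = -A 1 2 4) (i j : Fin 5) :
    dPhiXiComp A i j = 0 := by
  have d : ∀ k i, A k i i = 0 := fun k i => Lam2_diag (hA k) i
  have a10 : ∀ k, A k 1 0 = -A k 0 1 := fun k => Lam2_swap (hA k) 0 1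
  have a20 : ∀ k, A k 2 0 = -A k 0 2 := fun k => Lam2_swap (hA k) 0 2
  have a30 : ∀ k, A k 3 0 = -A k 0 3 := fun k => Lam2_swap (hA k) 0 3
  have a21 : ∀ k, A k 2 1 = -A k 1 2 := fun k => Lam2_swap (hA k) 1 2
  have a31 : ∀ k, A k 3 1 = -A k 1 3 := fun k => Lam2_swap (hA k) 1 3
  have a32 : ∀ k, A k 3 2 = -A k 2 3 := fun k => Lam2_swap (hA k) 2 3
  have a4 : ∀ k i, A k 4 i = -A k i 4 := fun k i => Lam2_swap (hA k) i 4
  obtain ⟨s, f1, f2, -, -, -, -⟩ := h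
  have s0 : ∀ i, A i i 4 = 0 := fun i => by linarith [s i i]
  have s1 : ∀ i, A 4 i 4 = 0 := fun i => by linarith [s 4 i, d i 4]
  have s10 := s 1 0
  have s20 := s 2 0
  have s30 := s 3 0
  have s21 := s 2 1
  have s31 := s 3 1
  have s32 := s 3 2
  fin_cases i <;> fin_cases j <;>
    simp [dPhiXiComp, bracketComp, phiSign, phiIdx, d, a10, a20, a30, a21, a31, a32, a4, s0, s1,
      s10, s20, s30, s21, s31, s32] <;> linarith

/-- Pairs containing 4 need no extra equations: `A k 4 4` vanishes by skewness of `A k`, and `h1`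
expresses ∇_ξ ξ = 0. -/
theorem skew_of_le {A : Tensor3} (hA : ∀ k, A k ∈ Lam2) (h1 : ∀ i, A 4 i 4 = 0)
    (h : A 0 0 4 = 0 ∧ A 1 1 4 = 0 ∧ A 2 2 4 = 0 ∧ A 3 3 4 = 0 ∧ A 0 1 4 = -A 1 0 4 ∧
      A 0 2 4 = -A 2 0 4 ∧ A 0 3 4 = -A 3 0 4 ∧ A 1 2 4 = -A 2 1 4 ∧ A 1 3 4 = -A 3 1 4 ∧
      A 2 3 4 = -A 3 2 4) (i j : Fin 5) : A i j 4 = -A j i 4 := by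
  obtain ⟨k0, k1, k2, k3, k01, k02, k03, k12, k13, k23⟩ := h
  have a4 : ∀ k, A k 4 4 = 0 := fun k => Lam2_diag (hA k) 4
  fin_cases i <;> fin_cases j <;> simp only [Fin.zero_eta, Fin.mk_one, Fin.reduceFinMk] <;>
    linarith [a4 0, a4 1, a4 2, a4 3, a4 4, h1 0, h1 1, h1 2, h1 3]

/-- The equations on the connection forms which express that `N` is totally skew-symmetric. -/
theorem eqs_of_nijenhuisComp {A : Tensor3} (hA : ∀ k, A k ∈ Lam2)
    (hN : ∀ i j k, nijenhuisComp A i j k + nijenhuisComp A j i k = 0) :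
    (∀ i, A 4 i 4 = 0) ∧ (A 4 0 2 - A 4 1 3 = A 0 2 4 - A 1 3 4 ∧
      A 4 0 3 + A 4 1 2 = A 0 3 4 + A 1 2 4 ∧ A 0 0 2 - A 0 1 3 = A 1 0 3 + A 1 1 2 ∧
      A 0 0 3 + A 0 1 2 = -(A 1 0 2 - A 1 1 3) ∧ A 2 0 2 - A 2 1 3 = A 3 0 3 + A 3 1 2 ∧
      A 2 0 3 + A 2 1 2 = -(A 3 0 2 - A 3 1 3)) ∧
    A 0 0 4 = A 1 1 4 ∧ A 2 2 4 = A 3 3 4 ∧ A 0 1 4 = -A 1 0 4 ∧ A 2 3 4 = -A 3 2 4 ∧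
      A 2 0 4 - A 3 1 4 = -(A 4 0 2 - A 4 1 3) ∧ A 2 1 4 + A 3 0 4 = -(A 4 0 3 + A 4 1 2) := by
  have d : ∀ k i, A k i i = 0 := fun k i => Lam2_diag (hA k) i
  have a10 : ∀ k, A k 1 0 = -A k 0 1 := fun k => Lam2_swap (hA k) 0 1
  have a20 : ∀ k, A k 2 0 = -A k 0 2 := fun k => Lam2_swap (hA k) 0 2
  have a30 : ∀ k, A k 3 0 = -A k 0 3 := fun k => Lam2_swap (hA k) 0 3
  have a21 : ∀ k, A k 2 1 = -A k 1 2 := fun k => Lam2_swap (hA k) 1 2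
  have a31 : ∀ k, A k 3 1 = -A k 1 3 := fun k => Lam2_swap (hA k) 1 3
  have a32 : ∀ k, A k 3 2 = -A k 2 3 := fun k => Lam2_swap (hA k) 2 3
  have a4 : ∀ k i, A k 4 i = -A k i 4 := fun k i => Lam2_swap (hA k) i 4
  -- Here N(ξ, ξ, e_k) = -`A 4 k 4`. Below, triples without index 4 give the equations on `A 0`, …,
  -- `A 3`; those with one index 4 give the equations on `A 4` and on the entries `A i j 4`.
  have n0 := hN 4 4 0
  have n1 := hN 4 4 1
  have n2 := hN 4 4 2
  have n3 := hN 4 4 3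
  have m002 := hN 0 0 2
  have m003 := hN 0 0 3
  have m004 := hN 0 0 4
  have m014 := hN 0 1 4
  have m042 := hN 0 4 2
  have m043 := hN 0 4 3
  have m220 := hN 2 2 0
  have m221 := hN 2 2 1
  have m224 := hN 2 2 4
  have m234 := hN 2 3 4
  have m240 := hN 2 4 0
  have m241 := hN 2 4 1
  simp [nijenhuisComp, bracketComp, phiSign, phiIdx, d, a10, a20, a30, a21, a31, a32, a4]
    at n0 n1 n2 n3 m002 m003 m004 m014 m042 m043 m220 m221 m224 m234 m240 m241
  refine ⟨fun i => ?_, ⟨?_, ?_, ?_, ?_, ?_, ?_⟩, ?_, ?_, ?_, ?_, ?_, ?_⟩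
  · fin_cases i <;> simp only [Fin.zero_eta, Fin.mk_one, Fin.reduceFinMk] <;> linarith [d 4 4]
  all_goals linarith

theorem isSkewTorsionType_iff_killing {A : Tensor3} (hA : ∀ k, A k ∈ Lam2) :
    IsSkewTorsionType A ↔
      (∀ i j k, nijenhuisComp A i j k + nijenhuisComp A j i k = 0) ∧ ∀ i j, A i j 4 = -A j i 4 := by
  refine ⟨fun h => ⟨nijenhuisComp_of_isSkewTorsionType hA h, h.skew⟩, fun ⟨hN, h⟩ => ?_⟩
  obtain ⟨-, ⟨f1, f2, z1, z2, t1, t2⟩, -⟩ := eqs_of_nijenhuisComp hA hN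
  exact ⟨h, f1, f2, z1, z2, t1, t2⟩

/-- For the converse put F = `A 4 0 3 + A 4 1 2`. Skewness of N gives F = `A 0 3 4 + A 1 2 4` = -(`A
2 1 4 + A 3 0 4`), and the difference of the components (0, 2) and (1, 3) of ξ ⌟ dΦ then reads 4F =
0. The same happens for `A 4 0 2 - A 4 1 3` with (0, 3) and (1, 2). The components (0, 1) and (2, 3)
kill the diagonal entries `A i i 4`, which N only makes equal in pairs. -/
theorem isSkewTorsionType_iff_dPhiXiComp {A : Tensor3} (hA : ∀ k, A k ∈ Lam2) :
    (IsSkewTorsionType A ∧ A 0 2 4 = A 1 3 4 ∧ A 0 3 4 = -A 1 2 4) ↔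
      (∀ i j k, nijenhuisComp A i j k + nijenhuisComp A j i k = 0) ∧
        ∀ i j, dPhiXiComp A i j = 0 := by
  refine ⟨fun ⟨h, h1, h2⟩ => ⟨nijenhuisComp_of_isSkewTorsionType hA h,
    dPhiXiComp_of_isSkewTorsionType hA h h1 h2⟩, fun ⟨hN, h⟩ => ?_⟩
  obtain ⟨h4, ⟨f1, f2, z1, z2, t1, t2⟩, g1, g2, g3, g4, g5, g6⟩ := eqs_of_nijenhuisComp hA hN
  have p01 := h 0 1
  have p02 := h 0 2
  have p03 := h 0 3
  have p12 := h 1 2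
  have p13 := h 1 3
  have p23 := h 2 3
  have s : ∀ k i j, A k j i = -A k i j := fun k => Lam2_swap (hA k)
  simp [dPhiXiComp, bracketComp, phiSign, phiIdx] at p01 p02 p03 p12 p13 p23
  refine ⟨⟨skew_of_le hA h4 ⟨?_, ?_, ?_, ?_, ?_, ?_, ?_, ?_, ?_, ?_⟩, f1, f2, z1, z2, t1, t2⟩,
    ?_, ?_⟩ <;>
    linarith [s 0 4 0, s 1 4 1, s 2 4 2, s 3 4 3, s 0 4 2, s 0 4 3, s 1 4 2, s 1 4 3, s 2 4 0,
      s 2 4 1, s 3 4 0, s 3 4 1, s 4 0 2, s 4 0 3, s 4 1 2, s 4 1 3, Lam2_diag (hA 4) 0,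
      Lam2_diag (hA 4) 1, Lam2_diag (hA 4) 2, Lam2_diag (hA 4) 3]

end ACM

namespace ACM

open scoped Topology

namespace AlmostContactMetric

/-! ### Linear algebra in a tangent space. -/

section

variable {M : Type*} [TopologicalSpace M] [ChartedSpace E5 M]

instance finiteDimensional_tangentSpace (p : M) :
    FiniteDimensional ℝ (TangentSpace (𝓡 5) p) :=
  inferInstanceAs (FiniteDimensional ℝ E5)

theorem finrank_tangentSpace (p : M) : Module.finrank ℝ (TangentSpace (𝓡 5) p) = 5 :=
  (finrank_euclideanSpace_fin : Module.finrank ℝ E5 = 5)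

end

variable {M : Type*} [TopologicalSpace M] [ChartedSpace E5 M] [IsManifold (𝓡 5) ∞ M]
  (S : AlmostContactMetric M)

theorem linearIndependent_of_orthonormal {n : ℕ} {p : M} {v : Fin n → TangentSpace (𝓡 5) p}
    (h : ∀ i j, S.g.inner p (v i) (v j) = if i = j then 1 else 0) : LinearIndependent ℝ v := by
  rw [Fintype.linearIndependent_iff]
  intro c hc i
  have := congrArg (S.g.inner p (v i)) hc
  simpa [map_sum, h] using this

theorem eq_zero_of_inner_self {p : M} {v : TangentSpace (𝓡 5) p} (h : S.g.inner p v v = 0) :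
    v = 0 := by
  by_contra hv
  exact (S.g.pos p v hv).ne' h

/-! ### The structure in an adapted frame -/

variable {S} {e : Fin 5 → Π p : M, TangentSpace (𝓡 5) p} {U : Set M}

namespace IsAdaptedFrameOn

theorem span_eq_top (he : S.IsAdaptedFrameOn e U) {p : M} (hp : p ∈ U) :
    Submodule.span ℝ (range fun i => e i p) = ⊤ :=
  (S.linearIndependent_of_orthonormal (he.orthonormal p hp)).span_eq_top_of_card_eq_finrank'
    (by simp [finrank_tangentSpace])

theorem ext_inner (he : S.IsAdaptedFrameOn e U) {p : M} (hp : p ∈ U) {v w : TangentSpace (𝓡 5) p}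
    (h : ∀ i, S.g.inner p (e i p) v = S.g.inner p (e i p) w) : v = w := by
  rw [← sub_eq_zero]
  apply S.eq_zero_of_inner_self
  have hspan : ∀ u ∈ Submodule.span ℝ (range fun i => e i p), S.g.inner p u (v - w) = 0 := by
    intro u hu
    induction hu using Submodule.span_induction with
    | mem x hx =>
      obtain ⟨i, rfl⟩ := hx
      rw [map_sub, h, sub_self]
    | zero => simp
    | add x y _ _ hx hy => rw [map_add, add_apply, hx, hy, add_zero]
    | smul c x _ hx => rw [map_smul, smul_apply, hx, smul_zero]
  exact hspan _ (by rw [he.span_eq_top hp]; trivial)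

theorem four_eq_xi (he : S.IsAdaptedFrameOn e U) {p : M} (hp : p ∈ U) : e 4 p = S.ξ p := by
  refine he.ext_inner hp fun i => ?_
  have h1 := he.orthonormal p hp i 4
  have h2 := he.eta_eq p hp i
  simp only [met, eta] at h1 h2
  rw [h1, S.g.symm, h2]
  fin_cases i <;> simp [stdEta]

theorem phi_frame (he : S.IsAdaptedFrameOn e U) {p : M} (hp : p ∈ U) (j : Fin 5) :
    S.phi (e j) p = (phiSign j • e (phiIdx j)) p := by
  refine he.ext_inner hp fun i => ?_
  have h1 := he.orthonormal p hp i (phiIdx j)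
  have h2 := he.Phi_eq p hp i j
  simp only [met, Phi] at h1 h2
  simp only [phi, Pi.smul_apply, map_smul, h1, h2]
  fin_cases i <;> fin_cases j <;> simp [stdPhi, phiSign, phiIdx]

theorem diffFieldAt (he : S.IsAdaptedFrameOn e U) (hU : IsOpen U) {p : M} (hp : p ∈ U)
    (i : Fin 5) : DiffFieldAt (e i) p :=
  (he.smooth i).mdifferentiableAt hU hp

theorem connectionForm_apply (he : S.IsAdaptedFrameOn e U) (hU : IsOpen U) {p : M} (hp : p ∈ U)
    (i j k : Fin 5) : S.connectionForm e p k i j =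
      (1 / 2) * (S.met (mlieBracket (𝓡 5) (e k) (e i)) (e j) p
        - S.met (mlieBracket (𝓡 5) (e i) (e j)) (e k) p
        + S.met (mlieBracket (𝓡 5) (e j) (e k)) (e i) p) := by
  have h : ∀ X : Π p : M, TangentSpace (𝓡 5) p, ∀ i j, dirDeriv X (S.met (e i) (e j)) p = 0 :=
    fun X i j => dirDeriv_of_eqOn_const X hU (fun q hq => he.orthonormal q hq i j) hp
  simp only [connectionForm, Matrix.of_apply, lcInner, h]
  ring

theorem connectionForm_mem_Lam2 (he : S.IsAdaptedFrameOn e U) (hU : IsOpen U) {p : M} (hp : p ∈ U)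
    (k : Fin 5) : S.connectionForm e p k ∈ Lam2 := by
  change (S.connectionForm e p k)ᵀ = -S.connectionForm e p k
  ext i j
  simp only [Matrix.transpose_apply, Matrix.neg_apply, he.connectionForm_apply hU hp, met,
    mlieBracket_swap_apply (V := e j) (W := e i), mlieBracket_swap_apply (V := e k) (W := e j),
    mlieBracket_swap_apply (V := e i) (W := e k), map_neg, neg_apply]
  ring

/-- This is torsion-freeness of the Levi-Civita connection, obtained directly from Koszul's formula.
-/
theorem met_mlieBracket (he : S.IsAdaptedFrameOn e U) (hU : IsOpen U) {p : M} (hp : p ∈ U)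
    (i j k : Fin 5) : S.met (mlieBracket (𝓡 5) (e i) (e j)) (e k) p =
      bracketComp (S.connectionForm e p) i j k := by
  simp only [bracketComp, he.connectionForm_apply hU hp, met,
    mlieBracket_swap_apply (V := e j) (W := e i), mlieBracket_swap_apply (V := e k) (W := e j),
    mlieBracket_swap_apply (V := e i) (W := e k), map_neg, neg_apply]
  ring

theorem mlieBracket_phi_left (he : S.IsAdaptedFrameOn e U) (hU : IsOpen U) {p : M} (hp : p ∈ U)
    (j : Fin 5) (Y : Π p : M, TangentSpace (𝓡 5) p) :
    mlieBracket (𝓡 5) (S.phi (e j)) Y p = phiSign j • mlieBracket (𝓡 5) (e (phiIdx j)) Y p := by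
  -- The bracket needs φe_j near p and not only at p. The factor is constant, so no derivative of it
  -- appears.
  have h : S.phi (e j) =ᶠ[𝓝 p] phiSign j • e (phiIdx j) :=
    Filter.eventuallyEq_of_mem (hU.mem_nhds hp) fun q hq => he.phi_frame hq j
  rw [Filter.EventuallyEq.mlieBracket_vectorField_eq (I := 𝓡 5) (W := Y) h
    Filter.EventuallyEq.rfl, mlieBracket_const_smul_left (he.diffFieldAt hU hp _)]

theorem mlieBracket_phi_right (he : S.IsAdaptedFrameOn e U) (hU : IsOpen U) {p : M} (hp : p ∈ U)
    (j : Fin 5) (X : Π p : M, TangentSpace (𝓡 5) p) :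
    mlieBracket (𝓡 5) X (S.phi (e j)) p = phiSign j • mlieBracket (𝓡 5) X (e (phiIdx j)) p := by
  rw [mlieBracket_swap_apply, he.mlieBracket_phi_left hU hp, mlieBracket_swap_apply (V := X),
    smul_neg]

theorem mlieBracket_xi_left (he : S.IsAdaptedFrameOn e U) (hU : IsOpen U) {p : M} (hp : p ∈ U)
    (Y : Π p : M, TangentSpace (𝓡 5) p) :
    mlieBracket (𝓡 5) S.ξ Y p = mlieBracket (𝓡 5) (e 4) Y p := by
  have h : S.ξ =ᶠ[𝓝 p] e 4 :=
    Filter.eventuallyEq_of_mem (hU.mem_nhds hp) fun q hq => (he.four_eq_xi hq).symm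
  exact Filter.EventuallyEq.mlieBracket_vectorField_eq (I := 𝓡 5) (W := Y) h
    Filter.EventuallyEq.rfl

theorem dEta_frame (he : S.IsAdaptedFrameOn e U) (hU : IsOpen U) {p : M} (hp : p ∈ U)
    (j k : Fin 5) : S.dEta (e j) (e k) p = -S.eta (mlieBracket (𝓡 5) (e j) (e k)) p := by
  have h : ∀ X : Π p : M, TangentSpace (𝓡 5) p, ∀ i, dirDeriv X (S.eta (e i)) p = 0 :=
    fun X i => dirDeriv_of_eqOn_const X hU (fun q hq => he.eta_eq q hq i) hp
  simp only [dEta, h]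
  ring

/-- The term η ⊗ dη cancels the ξ-part of φ²[e_j, e_k], so the two together contribute -g(e_i, [e_j,
e_k]) for every i, including the direction of ξ. -/
theorem nijenhuis_frame (he : S.IsAdaptedFrameOn e U) (hU : IsOpen U) {p : M} (hp : p ∈ U)
    (i j k : Fin 5) :
    S.nijenhuis (e i) (e j) (e k) p = nijenhuisComp (S.connectionForm e p) i j k := by
  have hφ : ∀ v : TangentSpace (𝓡 5) p, S.g.inner p (e i p) (S.φ p v) =
      -(phiSign i * S.g.inner p v (e (phiIdx i) p)) := by
    intro v
    have := he.phi_frame hp i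
    simp only [phi, Pi.smul_apply] at this
    rw [← neg_eq_iff_eq_neg, ← S.inner_phi_left, this, map_smul, smul_apply, smul_eq_mul, S.g.symm]
  have hb := fun i j k => he.met_mlieBracket hU hp i j k
  simp only [met] at hb
  rw [nijenhuis, he.dEta_frame hU hp]
  simp only [nijenhuisComp, met, nijenhuisTorsion, map_add, map_sub, hφ, S.φ_φ, eta,
    he.mlieBracket_phi_left hU hp, he.mlieBracket_phi_right hU hp, map_smul, map_neg, smul_eq_mul,
    ← hb]
  rw [S.g.symm p (e i p) (mlieBracket (𝓡 5) (e (phiIdx j)) (e (phiIdx k)) p),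
    S.g.symm p (e i p) (mlieBracket (𝓡 5) (e j) (e k) p), S.g.symm p (e i p) (S.ξ p)]
  ring

/-- Since `A i j 4` = g(∇_{e_i} e_j, ξ) = -g(∇_{e_i} ξ, e_j), the right-hand side is the
symmetrization of ∇ξ. -/
theorem lieDerivMet_frame (he : S.IsAdaptedFrameOn e U) (hU : IsOpen U) {p : M} (hp : p ∈ U)
    (i j : Fin 5) : S.lieDerivMet (e i) (e j) p =
      -(S.connectionForm e p i j 4 + S.connectionForm e p j i 4) := by
  have h : dirDeriv S.ξ (S.met (e i) (e j)) p = 0 :=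
    dirDeriv_of_eqOn_const _ hU (fun q hq => he.orthonormal q hq i j) hp
  have hb := fun i j k => he.met_mlieBracket hU hp i j k
  have hs := fun k => Lam2_swap (he.connectionForm_mem_Lam2 hU hp k)
  rw [lieDerivMet, h, S.met_comm (e i)]
  simp only [met, he.mlieBracket_xi_left hU hp] at hb ⊢
  rw [hb, hb, bracketComp, bracketComp, hs 4 i j, hs i 4 j, hs j 4 i]
  ring

theorem dPhi_xi_frame (he : S.IsAdaptedFrameOn e U) (hU : IsOpen U) {p : M} (hp : p ∈ U)
    (i j : Fin 5) : S.dPhi S.ξ (e i) (e j) p = dPhiXiComp (S.connectionForm e p) i j := by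
  have h : dirDeriv S.ξ (S.Phi (e i) (e j)) p = 0 :=
    dirDeriv_of_eqOn_const _ hU (fun q hq => he.Phi_eq q hq i j) hp
  have hb := fun i j k => he.met_mlieBracket hU hp i j k
  have hφ : ∀ j, S.φ p (e j p) = phiSign j • e (phiIdx j) p := fun j => he.phi_frame hp j
  rw [S.dPhi_xi, h]
  simp only [Phi, met, he.mlieBracket_xi_left hU hp, hφ, map_smul, smul_eq_mul] at hb ⊢
  rw [hb, hb, dPhiXiComp]
  simp only [bracketComp]
  ring

/-- A tensorial functional factors through a linear form on the tangent space at p, which the frame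
spans. Identities in several fields follow by applying this one slot at a time. -/
theorem eq_zero_of_tensorialAt (he : S.IsAdaptedFrameOn e U) (hU : IsOpen U) {p : M} (hp : p ∈ U)
    {T : (Π p : M, TangentSpace (𝓡 5) p) → ℝ} (hT : TensorialAt (𝓡 5) E5 T p)
    (h : ∀ i, T (e i) = 0) {X : Π p : M, TangentSpace (𝓡 5) p} (hX : DiffFieldAt X p) :
    T X = 0 := by
  have h0 : (hT.mkHom T p : TangentSpace (𝓡 5) p →ₗ[ℝ] ℝ) = 0 := by
    refine LinearMap.ext_on_range (he.span_eq_top hp) fun i => ?_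
    exact (hT.mkHom_apply (he.diffFieldAt hU hp i)).trans (h i)
  rw [← hT.mkHom_apply hX]
  exact LinearMap.congr_fun h0 (X p)

theorem nijenhuis_skew (he : S.IsAdaptedFrameOn e U) (hU : IsOpen U) {p : M} (hp : p ∈ U)
    (h : ∀ i j k, S.nijenhuis (e i) (e j) (e k) p + S.nijenhuis (e j) (e i) (e k) p = 0)
    {X Y Z : Π p : M, TangentSpace (𝓡 5) p} (hX : DiffFieldAt X p) (hY : DiffFieldAt Y p)
    (hZ : DiffFieldAt Z p) : S.nijenhuis X Y Z p + S.nijenhuis Y X Z p = 0 := by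
  have add : ∀ {T T' : (Π p : M, TangentSpace (𝓡 5) p) → ℝ}, TensorialAt (𝓡 5) E5 T p →
      TensorialAt (𝓡 5) E5 T' p → TensorialAt (𝓡 5) E5 (fun X => T X + T' X) p :=
    fun hT hT' => ⟨fun hf hX => by rw [hT.smul hf hX, hT'.smul hf hX, smul_add],
      fun hX hX' => by rw [hT.add hX hX', hT'.add hX hX']; ring⟩
  refine he.eq_zero_of_tensorialAt hU hp (add (S.tensorialAt_nijenhuis₁ Y Z)
    (S.tensorialAt_nijenhuis₂ Y Z)) (fun i => ?_) hX
  refine he.eq_zero_of_tensorialAt hU hp (add (S.tensorialAt_nijenhuis₂ (e i) Z)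
    (S.tensorialAt_nijenhuis₁ (e i) Z)) (fun j => ?_) hY
  exact he.eq_zero_of_tensorialAt hU hp (add (S.tensorialAt_nijenhuis₃ (e i) (e j))
    (S.tensorialAt_nijenhuis₃ (e j) (e i))) (fun k => h i j k) hZ

theorem lieDerivMet_eq_zero (he : S.IsAdaptedFrameOn e U) (hU : IsOpen U) {p : M} (hp : p ∈ U)
    (h : ∀ i j, S.lieDerivMet (e i) (e j) p = 0)
    {X Y : Π p : M, TangentSpace (𝓡 5) p} (hX : DiffFieldAt X p) (hY : DiffFieldAt Y p) :
    S.lieDerivMet X Y p = 0 :=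
  he.eq_zero_of_tensorialAt hU hp (S.tensorialAt_lieDerivMet₁ hY) (fun i =>
    he.eq_zero_of_tensorialAt hU hp (S.tensorialAt_lieDerivMet₂ (he.diffFieldAt hU hp i))
      (h i) hY) hX

theorem dPhi_xi_eq_zero (he : S.IsAdaptedFrameOn e U) (hU : IsOpen U) {p : M} (hp : p ∈ U)
    (h : ∀ i j, S.dPhi S.ξ (e i) (e j) p = 0)
    {X Y : Π p : M, TangentSpace (𝓡 5) p} (hX : DiffFieldAt X p) (hY : DiffFieldAt Y p) :
    S.dPhi S.ξ X Y p = 0 :=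
  he.eq_zero_of_tensorialAt hU hp (S.tensorialAt_dPhi_xi₁ hY) (fun i =>
    he.eq_zero_of_tensorialAt hU hp (S.tensorialAt_dPhi_xi₂ (he.diffFieldAt hU hp i))
      (h i) hY) hX

end IsAdaptedFrameOn

end AlmostContactMetric

end ACM

namespace ACM

open scoped Topology

namespace AlmostContactMetric

variable {M : Type*} [TopologicalSpace M] [ChartedSpace E5 M] [IsManifold (𝓡 5) ∞ M]
  (S : AlmostContactMetric M)

/-! ### Existence of adapted frames -/

/-- Fewer than five orthonormal vector fields can be extended locally by another one. -/
theorem exists_orthonormal_extension {n : ℕ} (hn : n < 5) {U : Set M} (hU : IsOpen U) {p : M}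
    (hp : p ∈ U) {f : Fin n → Π p : M, TangentSpace (𝓡 5) p} (hf : ∀ i, SmoothFieldOn (f i) U)
    (horth : ∀ q ∈ U, ∀ i j, S.met (f i) (f j) q = if i = j then 1 else 0) :
    ∃ V ⊆ U, IsOpen V ∧ p ∈ V ∧ ∃ X : Π p : M, TangentSpace (𝓡 5) p, SmoothFieldOn X V ∧
      ∀ q ∈ V, S.met X X q = 1 ∧ ∀ i, S.met (f i) X q = 0 := by
  obtain ⟨v, hv⟩ : ∃ v, v ∉ Submodule.span ℝ (range fun i => f i p) := by
    by_contra! h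
    have h1 := finrank_range_le_card (R := ℝ) fun i => f i p
    rw [Set.finrank, (Submodule.eq_top_iff'.2 h), finrank_top, finrank_tangentSpace,
      Fintype.card_fin] at h1
    omega
  obtain ⟨s, hs, hsm⟩ := FiberBundle.exists_contMDiffOn_extend (k := ∞) (𝓡 5) E5 v
  obtain ⟨V, hVs, hVo, hpV⟩ := mem_nhds_iff.1 (Filter.inter_mem hs (hU.mem_nhds hp))
  set Y : Π p : M, TangentSpace (𝓡 5) p := FiberBundle.extend E5 v with hY
  have hYV : SmoothFieldOn Y V := ContMDiffOn.mono hsm fun q hq => (hVs hq).1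
  have hfV : ∀ i, SmoothFieldOn (f i) V := fun i => (hf i).mono fun q hq => (hVs hq).2
  -- Gram–Schmidt: Y extends a vector outside the span of the given fields at p, so Z is orthogonal
  -- to them and nonzero at p.
  let Z : Π p : M, TangentSpace (𝓡 5) p := fun q => Y q - ∑ i, S.met (f i) Y q • f i q
  have hZ : SmoothFieldOn Z V :=
    ContMDiffOn.sub_section hYV (ContMDiffOn.sum_section fun i _ =>
      ContMDiffOn.smul_section (S.contMDiffOn_met (hfV i) hYV) (hfV i))
  have hZp : Z p ≠ 0 := by
    intro h
    apply hv
    have h1 : v = ∑ i, S.met (f i) Y p • f i p := by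
      have := sub_eq_zero.1 h
      rwa [hY, FiberBundle.extend_apply_self] at this
    rw [h1]
    exact Submodule.sum_mem _ fun i _ =>
      Submodule.smul_mem _ _ (Submodule.subset_span (mem_range_self i))
  have hZf : ∀ q ∈ V, ∀ i, S.met (f i) Z q = 0 := by
    intro q hq i
    have h := horth q (hVs hq).2
    simp only [met] at h
    simp [met, Z, map_sum, h]
  have hcont := (S.contMDiffOn_met hZ hZ).continuousOn
  -- On this open set the square root of g(Z, Z) is smooth and nonzero, so Z can be normalized.
  let W := V ∩ S.met Z Z ⁻¹' Ioi 0
  have hWo : IsOpen W := hcont.isOpen_inter_preimage hVo isOpen_Ioi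
  have hWV : W ⊆ V := inter_subset_left
  refine ⟨W, fun q hq => (hVs (hWV hq)).2, hWo, ⟨hpV, S.g.pos p _ hZp⟩,
    fun q => (Real.sqrt (S.met Z Z q))⁻¹ • Z q, ?_, fun q hq => ?_⟩
  · refine ContMDiffOn.smul_section ?_ (hZ.mono hWV)
    intro q hq
    have hpos : 0 < S.met Z Z q := hq.2
    have h1 : ContDiffAt ℝ ∞ (fun x : ℝ => (Real.sqrt x)⁻¹) (S.met Z Z q) :=
      (Real.contDiffAt_sqrt hpos.ne').inv (Real.sqrt_ne_zero'.2 hpos)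
    exact h1.contMDiffAt.comp_contMDiffWithinAt q ((S.contMDiffOn_met hZ hZ).mono hWV q hq)
  · have hpos : 0 < S.met Z Z q := hq.2
    have hsq := Real.mul_self_sqrt hpos.le
    have hne := Real.sqrt_ne_zero'.2 hpos
    refine ⟨?_, fun i => ?_⟩
    · have : S.met (fun q => (Real.sqrt (S.met Z Z q))⁻¹ • Z q)
          (fun q => (Real.sqrt (S.met Z Z q))⁻¹ • Z q) q =
          (Real.sqrt (S.met Z Z q))⁻¹ * ((Real.sqrt (S.met Z Z q))⁻¹ * S.met Z Z q) := by
        simp [met]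
      rw [this]
      field_simp
      linarith
    · have := hZf q (hWV hq) i
      simp only [met] at this
      simp [met, this]

theorem inner_phi_self {p : M} (v : TangentSpace (𝓡 5) p) : S.g.inner p v (S.φ p v) = 0 := by
  have := S.inner_phi_left p v v
  rw [S.g.symm] at this
  linarith

/-- The adapted basis `(x, -φx, y, -φy, ξ)` of a tangent space. -/
noncomputable def adaptedBasis {p : M} (x y : TangentSpace (𝓡 5) p) : Fin 5 → TangentSpace (𝓡 5) p :=
  ![x, -S.φ p x, y, -S.φ p y, S.ξ p]

/-- The minus signs in the basis are forced by Φ(x, -φx) = -g(x, φ²x) = g(x, x) = 1. -/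
theorem adaptedBasis_spec {p : M} {x y : TangentSpace (𝓡 5) p} (x1 : S.g.inner p x x = 1)
    (y1 : S.g.inner p y y = 1) (x2 : S.g.inner p (S.ξ p) x = 0) (y2 : S.g.inner p (S.ξ p) y = 0)
    (xy : S.g.inner p x y = 0) (xy' : S.g.inner p (S.φ p x) y = 0) :
    (∀ i j, S.g.inner p (S.adaptedBasis x y i) (S.adaptedBasis x y j) = if i = j then 1 else 0) ∧
      (∀ i j, S.g.inner p (S.adaptedBasis x y i) (S.φ p (S.adaptedBasis x y j)) = stdPhi i j) ∧
      ∀ i, S.g.inner p (S.ξ p) (S.adaptedBasis x y i) = stdEta i := by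
  have x3 : S.g.inner p x (S.ξ p) = 0 := by rw [S.g.symm, x2]
  have y3 : S.g.inner p y (S.ξ p) = 0 := by rw [S.g.symm, y2]
  have yx : S.g.inner p y x = 0 := by rw [S.g.symm, xy]
  have yx' : S.g.inner p y (S.φ p x) = 0 := by rw [S.g.symm, xy']
  have xφy : S.g.inner p x (S.φ p y) = 0 := by linarith [S.inner_phi_left p x y]
  have b0 : S.adaptedBasis x y 0 = x := rfl
  have b1 : S.adaptedBasis x y 1 = -S.φ p x := rfl
  have b2 : S.adaptedBasis x y 2 = y := rfl
  have b3 : S.adaptedBasis x y 3 = -S.φ p y := rfl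
  have b4 : S.adaptedBasis x y 4 = S.ξ p := rfl
  generalize S.adaptedBasis x y = w at *
  refine ⟨fun i j => ?_, fun i j => ?_, fun i => ?_⟩
  · fin_cases i <;> fin_cases j <;>
      simp [b0, b1, b2, b3, b4, S.inner_phi_left, S.φ_φ, S.φ_ξ, S.eta_phi, S.inner_phi_self,
        S.unit_ξ, x1, y1, x2, y2, x3, y3, xy, yx, yx', xφy]
  · fin_cases i <;> fin_cases j <;>
      simp [b0, b1, b2, b3, b4, S.inner_phi_left, S.φ_φ, S.φ_ξ, S.eta_phi, S.inner_phi_self,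
        x1, y1, x2, y2, xy, yx, yx', xφy, stdPhi]
  · fin_cases i <;> simp [b0, b1, b2, b3, b4, S.eta_phi, S.unit_ξ, x2, y2, stdEta]

/-- Adapted frames exist near every point. -/
theorem exists_isAdaptedFrameOn {U : Set M} (hU : IsOpen U) {p : M} (hp : p ∈ U) :
    ∃ V ⊆ U, IsOpen V ∧ p ∈ V ∧ ∃ e, S.IsAdaptedFrameOn e V := by
  obtain ⟨V, hVU, hV, hpV, X, hX, hXo⟩ := S.exists_orthonormal_extension (n := 1) (by norm_num)
    hU hp (f := ![S.ξ]) (fun i => by fin_cases i; exact S.smooth_ξ.mono (subset_univ U))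
    (fun q _ i j => by fin_cases i; fin_cases j; simpa [met] using S.unit_ξ q)
  have hφX := S.smoothFieldOn_phi hX
  have hX1 : ∀ q ∈ V, S.g.inner q (X q) (X q) = 1 := fun q hq => (hXo q hq).1
  have hXξ : ∀ q ∈ V, S.g.inner q (S.ξ q) (X q) = 0 := fun q hq => (hXo q hq).2 0
  have hXφ : ∀ q, S.g.inner q (X q) (S.φ q (X q)) = 0 := fun q => S.inner_phi_self _
  have hφX1 : ∀ q ∈ V, S.g.inner q (S.φ q (X q)) (S.φ q (X q)) = 1 := fun q hq => by
    rw [S.compat, hX1 q hq, hXξ q hq]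
    ring
  -- Orthogonality of Y to φX is required as well; by skewness of φ it makes φY orthogonal to X.
  obtain ⟨W, hWV, hW, hpW, Y, hY, hYo⟩ := S.exists_orthonormal_extension (n := 3) (by norm_num)
    hV hpV (f := ![S.ξ, X, S.phi X])
    (fun i => by
      fin_cases i
      · exact S.smooth_ξ.mono (subset_univ V)
      · exact hX
      · exact hφX)
    (fun q hq i j => by
      fin_cases i <;> fin_cases j <;>
        simp [met, phi, S.unit_ξ, hX1 q hq, hXξ q hq, hXφ, hφX1 q hq, S.eta_phi,
          S.g.symm q _ (S.ξ q), S.g.symm q (S.φ q (X q)) (X q)])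
  have hφY := S.smoothFieldOn_phi hY
  have hY1 : ∀ q ∈ W, S.g.inner q (Y q) (Y q) = 1 := fun q hq => (hYo q hq).1
  have hYξ : ∀ q ∈ W, S.g.inner q (S.ξ q) (Y q) = 0 := fun q hq => (hYo q hq).2 0
  have hYX : ∀ q ∈ W, S.g.inner q (X q) (Y q) = 0 := fun q hq => (hYo q hq).2 1
  have hYφX : ∀ q ∈ W, S.g.inner q (S.φ q (X q)) (Y q) = 0 := fun q hq => (hYo q hq).2 2
  have hpt := fun q hq => S.adaptedBasis_spec (hX1 q (hWV hq)) (hY1 q hq) (hXξ q (hWV hq))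
    (hYξ q hq) (hYX q hq) (hYφX q hq)
  refine ⟨W, hWV.trans hVU, hW, hpW, fun i q => S.adaptedBasis (X q) (Y q) i, fun i => ?_,
    fun q hq i j => (hpt q hq).1 i j, fun q hq i j => (hpt q hq).2.1 i j,
    fun q hq i => (hpt q hq).2.2 i⟩
  fin_cases i
  · exact hX.mono hWV
  · exact ContMDiffOn.neg_section (hφX.mono hWV)
  · exact hY
  · exact ContMDiffOn.neg_section hφY
  · exact S.smooth_ξ.mono (subset_univ W)

/-! ### Reformulation of all conditions in adapted frames. -/

theorem isOfClass_iff_forall_frame (W : Submodule ℝ Tensor3) (P : Tensor3 → Prop)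
    (h : ∀ {A : Tensor3}, (∀ k, A k ∈ Lam2) → (prW A ∈ W ↔ P A)) :
    S.IsOfClass W ↔ ∀ U : Set M, IsOpen U → ∀ e : Fin 5 → Π p : M, TangentSpace (𝓡 5) p,
      S.IsAdaptedFrameOn e U → ∀ p ∈ U, P (S.connectionForm e p) :=
  forall₅_congr fun _ hU _ he _ => forall_congr' fun hp => h (he.connectionForm_mem_Lam2 hU hp)

/-- Frame fields are admissible test fields; conversely, an adapted frame near the point and
tensoriality recover arbitrary fields. The next two equivalences have the same pattern. -/
theorem nijenhuisTotallySkew_iff : S.NijenhuisTotallySkew ↔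
    ∀ U : Set M, IsOpen U → ∀ e : Fin 5 → Π p : M, TangentSpace (𝓡 5) p,
      S.IsAdaptedFrameOn e U → ∀ p ∈ U, ∀ i j k, nijenhuisComp (S.connectionForm e p) i j k +
        nijenhuisComp (S.connectionForm e p) j i k = 0 := by
  constructor
  · intro h U hU e he p hp i j k
    rw [← he.nijenhuis_frame hU hp, ← he.nijenhuis_frame hU hp]
    exact h U hU _ _ _ (he.smooth i) (he.smooth j) (he.smooth k) p hp
  · intro h U hU X Y Z hX hY hZ p hp
    obtain ⟨V, -, hV, hpV, e, he⟩ := S.exists_isAdaptedFrameOn hU hp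
    refine he.nijenhuis_skew hV hpV (fun i j k => ?_) (hX.mdifferentiableAt hU hp)
      (hY.mdifferentiableAt hU hp) (hZ.mdifferentiableAt hU hp)
    rw [he.nijenhuis_frame hV hpV, he.nijenhuis_frame hV hpV]
    exact h V hV e he p hpV i j k

theorem isKilling_iff : S.IsKilling ↔
    ∀ U : Set M, IsOpen U → ∀ e : Fin 5 → Π p : M, TangentSpace (𝓡 5) p,
      S.IsAdaptedFrameOn e U → ∀ p ∈ U, ∀ i j,
        S.connectionForm e p i j 4 = -S.connectionForm e p j i 4 := by
  constructor
  · intro h U hU e he p hp i j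
    have h' := he.lieDerivMet_frame hU hp i j
    rw [lieDerivMet, h U hU _ _ (he.smooth i) (he.smooth j) p hp] at h'
    linarith
  · intro h U hU X Y hX hY p hp
    obtain ⟨V, -, hV, hpV, e, he⟩ := S.exists_isAdaptedFrameOn hU hp
    refine he.lieDerivMet_eq_zero hV hpV (fun i j => ?_) (hX.mdifferentiableAt hU hp)
      (hY.mdifferentiableAt hU hp)
    rw [he.lieDerivMet_frame hV hpV, h V hV e he p hpV i j]
    ring

theorem contractionDPhiVanishes_iff : S.ContractionDPhiVanishes ↔
    ∀ U : Set M, IsOpen U → ∀ e : Fin 5 → Π p : M, TangentSpace (𝓡 5) p,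
      S.IsAdaptedFrameOn e U → ∀ p ∈ U, ∀ i j, dPhiXiComp (S.connectionForm e p) i j = 0 := by
  constructor
  · intro h U hU e he p hp i j
    rw [← he.dPhi_xi_frame hU hp]
    exact h U hU _ _ (he.smooth i) (he.smooth j) p hp
  · intro h U hU X Y hX hY p hp
    obtain ⟨V, -, hV, hpV, e, he⟩ := S.exists_isAdaptedFrameOn hU hp
    refine he.dPhi_xi_eq_zero hV hpV (fun i j => ?_) (hX.mdifferentiableAt hU hp)
      (hY.mdifferentiableAt hU hp)
    rw [he.dPhi_xi_frame hV hpV]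
    exact h V hV e he p hpV i j

end AlmostContactMetric

end ACM

theorem proposition1 {M : Type*} [TopologicalSpace M] [ChartedSpace ACM.E5 M]
    [IsManifold (𝓡 5) ∞ M] (S : ACM.AlmostContactMetric M) :
    (S.IsOfClass (ACM.W3 ⊔ ACM.W4 ⊔ ACM.W5 ⊔ ACM.W6) ↔
      S.NijenhuisTotallySkew ∧ S.IsKilling) ∧
    (S.IsOfClass (ACM.W3 ⊔ ACM.W5 ⊔ ACM.W6) ↔
      S.NijenhuisTotallySkew ∧ S.ContractionDPhiVanishes) := by
  rw [S.isOfClass_iff_forall_frame _ _ fun hA =>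
      (ACM.prW_mem_W3456_iff hA).trans (ACM.isSkewTorsionType_iff_killing hA),
    S.isOfClass_iff_forall_frame _ _ fun hA =>
      (ACM.prW_mem_W356_iff hA).trans (ACM.isSkewTorsionType_iff_dPhiXiComp hA),
    S.nijenhuisTotallySkew_iff, S.isKilling_iff, S.contractionDPhiVanishes_iff]
  -- All conditions now quantify over the same frames and points, so the conjunctions split
  -- pointwise.
  exact ⟨⟨fun h => ⟨fun U hU e he p hp => (h U hU e he p hp).1,
      fun U hU e he p hp => (h U hU e he p hp).2⟩,
    fun h U hU e he p hp => ⟨h.1 U hU e he p hp, h.2 U hU e he p hp⟩⟩,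
    fun h => ⟨fun U hU e he p hp => (h U hU e he p hp).1,
      fun U hU e he p hp => (h U hU e he p hp).2⟩,
    fun h U hU e he p hp => ⟨h.1 U hU e he p hp, h.2 U hU e he p hp⟩⟩
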